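/- Let $R$ be a finite Frobenius ring, i.e. a finite ring (with $1$, not necessarily commutative) with a character $\chi$ of $(R,+)$ whose kernel contains no nonzero left ideal. Let $\mathrm{w}(x)=1-\frac1{|R^\times|}\sum_{u\in R^\times}\chi(ux)$ be the normalized homogeneous weight on $R$, which does not depend on the choice of $\chi$, extended to words by $\mathrm{w}(\mathbf c)=\sum_j \mathrm{w}(c_j)$. A left linear code $C\le {}_RR^n$ without all-zero coordinate, generated as $C=\{\mathbf xG : \mathbf x\in R^k\}$ by a matrix $G=(\mathbf g_1|\cdots|\mathbf g_n)\in R^{k\times n}$, is called modular of index $r\in\mathbb Q$ if for every nonzero $\mathbf g\in R^k$ the number $|\{j : \mathbf g_jR=\mathbf gR\}|$ is either $0$ or $r\,|\mathbf gR^\times|$. A linear (left or right) code $C$ is called a two-weight code with weights $w_1<w_2$ if the set of nonzero values of $\mathrm{w}$ on $C$ is exactly $\{w_1,w_2\}$; then $C_0$ and $C_1$ denote the sets of words of weight $0$ and $w_1$ in $C$. The set $C_0$ is a subgroup of $C$, and $\Gamma(C)$ denotes the Cayley graph of $C/C_0$ with respect to $C_1/C_0$: two distinct cosets $\mathbf c+C_0$,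 $\mathbf d+C_0$ are adjacent iff $\mathrm{w}(\mathbf c-\mathbf d)=w_1$. A graph is called trivial if it or its complement is a disjoint union of cliques of the same size. Let $C\le{}_RR^n$ be a modular two-weight code of index $r$ with nonzero weights $w_1<w_2$ and with $C_0=\{\mathbf 0\}$. Let $M_1$ be a matrix whose rows are the $b_1=|C_1|$ codewords of weight $w_1$ in $C$, each listed once, in some order, and let the dual $C'\le R^{b_1}_R$ be the right linear code generated by the columns of $M_1$. Then $C'$ is a two-weight code, say with nonzero weights $w_1'<w_2'$, and the graph $\Gamma(C')$, formed with the smaller weight $w_1'$, is strongly regular with parameters $$N'=|C|,\quad K'=\frac nr,\quad \lambda'=\frac{2n-w_1-w_2}{r}+\frac{w_1w_2}{r^2|C|},\quad \mu'=\frac{w_1w_2}{r^2|C|}.$$ Moreover, $\Gamma(C')$ is trivial if and only if $w_1=n$, and $\Gamma(C')$ is trivial if and only if $\Gamma(C)$ is trivial. -/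

import Mathlib

open scoped MulOpposite Matrix

namespace TwoWeight

noncomputable section

/-- A generating character of the ring `R`: an additive character whose kernel contains no nonzero
left ideal. A finite ring is a Frobenius ring iff it has such a character. -/
def IsGeneratingCharacter {R : Type*} [Ring R] (χ : AddChar R ℂ) : Prop :=
  ∀ I : Ideal R, (∀ x ∈ I, χ x = 1) → I = ⊥

/-- The normalized homogeneous weight `1 - |Rˣ|⁻¹ ∑ᵤ χ(u x)` on a finite Frobenius ring with
generating character `χ`. -/
def homWeight {R : Type*} [Ring R] [Finite R] (χ : AddChar R ℂ) (x : R) : ℂ :=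
  1 - (∑ᶠ u : Rˣ, χ ((u : R) * x)) / (Nat.card Rˣ : ℂ)

/-- The homogeneous weight of a word. -/
def wordWeight {R : Type*} [Ring R] [Finite R] (χ : AddChar R ℂ) {n : ℕ} (c : Fin n → R) : ℂ :=
  ∑ j, homWeight χ (c j)

/-- The additive code `C` has exactly two nonzero homogeneous weights, namely `w₁ < w₂`. -/
def IsTwoWeightCode {R : Type*} [Ring R] [Finite R] (χ : AddChar R ℂ) {n : ℕ}
    (C : AddSubgroup (Fin n → R)) (w₁ w₂ : ℝ) : Prop :=
  w₁ < w₂ ∧ {t : ℂ | t ≠ 0 ∧ ∃ c ∈ C, wordWeight χ c = t} = {(w₁ : ℂ), (w₂ : ℂ)}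

/-- The cyclic right submodule `gR` of `R^k`; for `g ≠ 0`, a point of the projective geometry. -/
def point {R : Type*} [Ring R] {k : ℕ} (g : Fin k → R) : Submodule Rᵐᵒᵖ (Fin k → R) :=
  Submodule.span Rᵐᵒᵖ {g}

/-- The multiplicity of the point `gR` in the multiset of points spanned by the columns of `G`. -/
def pointMultiplicity {R : Type*} [Ring R] {k n : ℕ} (G : Matrix (Fin k) (Fin n) R)
    (g : Fin k → R) : ℕ :=
  Nat.card {j : Fin n // point (fun i => G i j) = point g}

/-- The set `g Rˣ`. -/
def unitOrbit {R : Type*} [Ring R] {k : ℕ} (g : Fin k → R) : Set (Fin k → R) :=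
  Set.range fun (u : Rˣ) (i : Fin k) => g i * (u : R)

/-- A left linear code without all-zero coordinate is modular of index `r` if, for a generator
matrix `G`, every point `gR` has multiplicity `0` or `r * |g Rˣ|` among the columns of `G`. -/
def IsModularCode {R : Type*} [Ring R] {n : ℕ} (C : Submodule R (Fin n → R)) (r : ℚ) : Prop :=
  (∀ j, ∃ c ∈ C, c j ≠ 0) ∧
  ∃ (k : ℕ) (G : Matrix (Fin k) (Fin n) R),
    (C : Set (Fin n → R)) = Set.range (fun x : Fin k → R => x ᵥ* G) ∧
    ∀ g : Fin k → R, g ≠ 0 →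
      pointMultiplicity G g = 0 ∨ (pointMultiplicity G g : ℚ) = r * ((unitOrbit g).ncard : ℚ)

/-- The right linear code generated by the columns of a matrix. -/
def rightColumnCode {R : Type*} [Ring R] {m n : ℕ} (M : Matrix (Fin m) (Fin n) R) :
    Submodule Rᵐᵒᵖ (Fin m → R) :=
  Submodule.span Rᵐᵒᵖ (Set.range fun (j : Fin n) (i : Fin m) => M i j)

/-- The subgroup `C₀` of words of weight `0`. (For a generating character these words already form
a subgroup, so that the closure adds nothing.) -/
def zeroWeightSubgroup {R : Type*} [Ring R] [Finite R] (χ : AddChar R ℂ) {n : ℕ}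
    (C : AddSubgroup (Fin n → R)) : AddSubgroup C :=
  AddSubgroup.closure {c : C | wordWeight χ (c : Fin n → R) = 0}

/-- The graph `Γ(C)`: the Cayley graph of `C / C₀` with respect to `C₁ / C₀`, where `C₁` is the
set of words of weight `w₁`. -/
def codeGraph {R : Type*} [Ring R] [Finite R] (χ : AddChar R ℂ) {n : ℕ}
    (C : AddSubgroup (Fin n → R)) (w₁ : ℝ) : SimpleGraph (C ⧸ zeroWeightSubgroup χ C) :=
  SimpleGraph.addCayley
    ((fun c : C => (QuotientAddGroup.mk c : C ⧸ zeroWeightSubgroup χ C)) ''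
      {c : C | wordWeight χ (c : Fin n → R) = (w₁ : ℂ)})

/-- Strong regularity with parameters `(N, K, ℓ, μ)` of a graph on a finite vertex set. -/
def IsStronglyRegular {V : Type*} [Finite V] (Γ : SimpleGraph V) (N K ℓ μ : ℕ) : Prop :=
  letI : Fintype V := Fintype.ofFinite V
  letI : DecidableRel Γ.Adj := Classical.decRel _
  Γ.IsSRGWith N K ℓ μ

/-- `Γ` is a disjoint union of cliques of the same size. -/
def IsUnionOfEqualCliques {V : Type*} (Γ : SimpleGraph V) : Prop :=
  ∃ s : Setoid V, (∀ v w, Γ.Adj v w ↔ v ≠ w ∧ s v w) ∧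
    ∀ v w, {x | s v x}.ncard = {x | s w x}.ncard

/-- The graph or its complement is a disjoint union of cliques of the same size. -/
def IsTrivialGraph {V : Type*} (Γ : SimpleGraph V) : Prop :=
  IsUnionOfEqualCliques Γ ∨ IsUnionOfEqualCliques Γᶜ

end

end TwoWeight

/-! Everything takes place in the finite abelian group `C` and its character group. Let `S` be the
set of characters `c ↦ χ (c_j u)`, with `j` a coordinate and `u` a unit. Over a finite ring,
generators of the same cyclic module differ by a unit (stable range one). Modularity therefore says
that each element of `S` comes from exactly `r |Rˣ|` pairs `(j, u)`, and so `w(c) = n - r ∑_{ψ ∈ S}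
ψ(c)`. Thus the Cayley graph of `S` on the character group has eigenvalue `n / r` at `c = 0` and
only the eigenvalues `(n - w₁) / r` and `(n - w₂) / r` elsewhere. Fourier inversion of the squared
eigenvalue function counts common neighbours and gives the parameters.

This graph is `Γ(C')`. Since `χ` is generating, every character of `C` has the form `c ↦ χ (c ⬝ᵥ
a)`, and the word `M₁ *ᵥ a` has weight `|C₁|` minus the sum of this character over `C₁`. Inverting
the affine relation above shows that this sum has one value on `S` and a smaller one on the other
nontrivial characters. So `C'` is isomorphic to the character group, and its words of smaller
nonzero weight correspond to `S`.

A Cayley graph is trivial iff its connection set with `0` adjoined, or the complement of that set,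
is a subgroup. A character sums over a subgroup to `0` or to the full order. This excludes the first
case for both graphs and reduces the second to `w₁ = n`. -/

namespace TwoWeight

/-! ### Stable range one for finite rings -/

/-- An element of a finite ring that is not a unit has a nonzero left annihilator. -/
theorem exists_mul_eq_zero_of_not_isUnit {R : Type*} [Ring R] [Finite R] {c : R}
    (hc : ¬ IsUnit c) : ∃ k : R, k ≠ 0 ∧ k * c = 0 := by
  by_contra! h
  apply hc
  have hinj : Function.Injective fun x : R => x * c := by
    intro x y hxy
    by_contra hne
    exact h (x - y) (sub_ne_zero.2 hne) (by simpa [sub_mul, sub_eq_zero] using hxy)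
  obtain ⟨d, hd⟩ := (Finite.injective_iff_surjective.1 hinj) 1
  have hd' : c * d = 1 := by
    apply hinj
    simp only [mul_assoc, one_mul]
    simp only at hd
    rw [hd, mul_one]
  exact ⟨⟨c, d, hd', hd⟩, rfl⟩

/-- A finite semisimple ring has stable range one. -/
theorem exists_add_isUnit_of_isSemisimpleRing {R : Type*} [Ring R] [Finite R] [IsSemisimpleRing R]
    (J : Ideal R) (b : R) (h : ∃ a, ∃ j ∈ J, a * b + j = 1) : ∃ j ∈ J, IsUnit (b + j) := by
  -- Choose `c` in the coset `b + J` with `Rc` maximal. If `c` is not a unit, it can be changed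
  -- within the coset so that `Rc` grows strictly.
  obtain ⟨c, ⟨j₀, hj₀, rfl⟩, hmax⟩ :=
    (Set.toFinite {c | ∃ j ∈ J, b + j = c}).exists_maximalFor (fun c => Ideal.span {c}) _
      ⟨b, 0, J.zero_mem, add_zero b⟩
  refine ⟨j₀, hj₀, ?_⟩
  by_contra hunit
  obtain ⟨k₀, hk₀, hk₀c⟩ := exists_mul_eq_zero_of_not_isUnit hunit
  set c := b + j₀ with hc
  obtain ⟨D, hD⟩ := exists_isCompl (Ideal.span {c} ⊓ J)
  obtain ⟨a, j, hj, haj⟩ := h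
  have htop : Ideal.span {c} ⊔ J = ⊤ := by
    rw [Ideal.eq_top_iff_one]
    have h1 : a * c + (j - a * j₀) = 1 := by rw [← haj, hc]; noncomm_ring
    rw [← h1]
    exact Submodule.add_mem_sup (Ideal.mul_mem_left _ _ (Ideal.mem_span_singleton_self c))
      (J.sub_mem hj (J.mul_mem_left _ hj₀))
  have hdisj : Ideal.span {c} ⊓ (D ⊓ J) = ⊥ := by
    rw [inf_comm D, ← inf_assoc]; exact hD.inf_eq_bot
  have htop' : Ideal.span {c} ⊔ (D ⊓ J) = ⊤ := by
    have h2 : (Ideal.span {c} ⊓ J) ⊔ (D ⊓ J) = J := by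
      rw [← sup_inf_assoc_of_le D (inf_le_right : Ideal.span {c} ⊓ J ≤ J), hD.sup_eq_top,
        top_inf_eq]
    rw [eq_top_iff, ← htop]
    refine sup_le le_sup_left ?_
    conv_lhs => rw [← h2]
    exact sup_le_sup_right inf_le_left _
  -- Now the ring is the direct sum of `Rc` and `J'`, with `J'` inside `J`.
  obtain ⟨J', hJ'⟩ : ∃ J', J' = D ⊓ J := ⟨_, rfl⟩
  rw [← hJ'] at hdisj htop'
  let K : Ideal R := LinearMap.ker (LinearMap.toSpanSingleton R R c)
  have hK : ∀ x, x ∈ K ↔ x * c = 0 := fun x => by simp [K]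
  obtain ⟨L, hL⟩ := exists_isCompl K
  obtain ⟨e, he, l, hl, hel⟩ := Submodule.mem_sup.1
    (hL.sup_eq_top ▸ Submodule.mem_top : (1 : R) ∈ K ⊔ L)
  have hke : ∀ k ∈ K, k * e = k := by
    intro k hk
    have h3 : k * l = k - k * e :=
      eq_sub_of_add_eq (by rw [← mul_add, add_comm, hel, mul_one])
    have h4 : k * l ∈ K ⊓ L :=
      ⟨h3 ▸ K.sub_mem hk (K.mul_mem_left _ he), L.mul_mem_left _ hl⟩
    rw [hL.inf_eq_bot, Submodule.mem_bot, h3, sub_eq_zero] at h4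
    exact h4.symm
  -- If `K` annihilated `J'`, right multiplication by `c` would be surjective on the left
  -- annihilator of `J'`, hence injective by finiteness, yet it kills `k₀ ≠ 0`.
  obtain ⟨k, hk, j', hj', hkj⟩ : ∃ k ∈ K, ∃ j' ∈ J', k * j' ≠ 0 := by
    by_contra! h0
    obtain ⟨x, hx, y, hy, hxy⟩ := Submodule.mem_sup.1
      (htop' ▸ Submodule.mem_top : (1 : R) ∈ Ideal.span {c} ⊔ J')
    obtain ⟨a', rfl⟩ := Ideal.mem_span_singleton'.1 hx
    let A : Set R := {x | ∀ j ∈ J', x * j = 0}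
    let f : A → A := fun x => ⟨x * c, fun j hj => by
      rw [mul_assoc]; exact x.2 _ (J'.mul_mem_left _ hj)⟩
    have hf : Function.Surjective f := by
      intro x
      refine ⟨⟨x * a', fun j hj => by rw [mul_assoc]; exact x.2 _ (J'.mul_mem_left _ hj)⟩, ?_⟩
      apply Subtype.ext
      change (x : R) * a' * c = x
      conv_rhs => rw [← mul_one (x : R), ← hxy, mul_add, x.2 y hy, add_zero, ← mul_assoc]
    have hinj := Finite.injective_iff_surjective.2 hf
    have := @hinj ⟨k₀, fun j hj => h0 k₀ ((hK _).2 hk₀c) j hj⟩ ⟨0, fun j _ => zero_mul j⟩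
      (Subtype.ext (by simp [f, hk₀c]))
    exact hk₀ (congrArg Subtype.val this)
  have hJ'J : J' ≤ J := hJ' ▸ inf_le_right
  have hec : e * c = 0 := (hK e).1 he
  have hee : e * e = e := hke e he
  -- The generator `c + e j'` recovers `c` through `1 - e`, because `e c = 0` and `e` is idempotent.
  -- It also yields `k j'`, a nonzero element of `J'` and so outside `Rc`.
  have hcmem : c ∈ Ideal.span {c + e * j'} := by
    rw [Ideal.mem_span_singleton']
    refine ⟨1 - e, ?_⟩
    rw [sub_mul, one_mul, mul_add e, hec, ← mul_assoc, hee, zero_add, add_sub_cancel_right]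
  have hle := hmax (j := c + e * j')
    ⟨j₀ + e * j', J.add_mem hj₀ (J.mul_mem_left _ (hJ'J hj')), by rw [hc]; abel⟩
    (by simpa [Ideal.span_singleton_le_iff_mem] using hcmem)
  have h5 : k * j' ∈ Ideal.span {c} ⊓ J' := by
    refine ⟨hle (Ideal.mem_span_singleton'.2 ⟨k, ?_⟩), J'.mul_mem_left _ hj'⟩
    rw [mul_add, (hK k).1 hk, ← mul_assoc, hke k hk, zero_add]
  rw [hdisj] at h5
  exact hkj h5

/-- Units lift modulo the Jacobson radical of a finite ring. -/
theorem isUnit_of_isUnit_mk_jacobson {R : Type*} [Ring R] [Finite R] {x : R}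
    (h : IsUnit (Ideal.Quotient.mk (Ring.jacobson R) x)) : IsUnit x := by
  obtain ⟨y, hy⟩ := h.exists_left_inv
  obtain ⟨y, rfl⟩ := Ideal.Quotient.mk_surjective y
  by_contra hx
  obtain ⟨k, hk, hkx⟩ := exists_mul_eq_zero_of_not_isUnit hx
  obtain ⟨z, hz⟩ := h.exists_right_inv
  obtain ⟨z, rfl⟩ := Ideal.Quotient.mk_surjective z
  have hmem : x * z - 1 ∈ Ring.jacobson R := by
    rw [← Ideal.Quotient.eq_zero_iff_mem, map_sub, map_mul, hz, map_one, sub_self]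
  obtain ⟨m, hm⟩ := IsSemiprimaryRing.isNilpotent (R := R)
  have hnil : IsNilpotent (x * z - 1) :=
    ⟨m, by simpa [hm] using Ideal.pow_mem_pow hmem m⟩
  have hu : IsUnit (x * z) := by simpa using hnil.isUnit_add_one
  exact hk ((hu.mul_left_eq_zero).1 (by rw [← mul_assoc, hkx, zero_mul]))

/-- A finite ring has stable range one. -/
theorem exists_add_isUnit {R : Type*} [Ring R] [Finite R]
    (J : Ideal R) (b : R) (h : ∃ a, ∃ j ∈ J, a * b + j = 1) : ∃ j ∈ J, IsUnit (b + j) := by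
  have : IsSemisimpleRing (R ⧸ Ring.jacobson R) := IsSemiprimaryRing.isSemisimpleRing
  have : Finite (R ⧸ Ring.jacobson R) := Finite.of_surjective _ Ideal.Quotient.mk_surjective
  obtain ⟨a, j, hj, haj⟩ := h
  obtain ⟨t, ht, htu⟩ := exists_add_isUnit_of_isSemisimpleRing
    (J.map (Ideal.Quotient.mk (Ring.jacobson R))) (Ideal.Quotient.mk _ b)
    ⟨Ideal.Quotient.mk _ a, Ideal.Quotient.mk _ j, Ideal.mem_map_of_mem _ hj, by
      rw [← map_mul, ← map_add, haj, map_one]⟩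
  obtain ⟨s, hs, rfl⟩ := (Ideal.mem_map_iff_of_surjective _ Ideal.Quotient.mk_surjective).1 ht
  exact ⟨s, hs, isUnit_of_isUnit_mk_jacobson (by rwa [map_add])⟩

/-- Generators of a cyclic module over a finite ring differ by a unit. -/
theorem exists_unit_smul_eq_of_span_eq {R M : Type*} [Ring R] [Finite R] [AddCommGroup M]
    [Module R M] {g h : M} (hgh : Submodule.span R {g} = Submodule.span R {h}) :
    ∃ u : Rˣ, u • g = h := by
  obtain ⟨b, hb⟩ := Submodule.mem_span_singleton.1 (hgh ▸ Submodule.mem_span_singleton_self h)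
  obtain ⟨a, ha⟩ := Submodule.mem_span_singleton.1 (hgh ▸ Submodule.mem_span_singleton_self g)
  obtain ⟨j, hj, u, hu⟩ := exists_add_isUnit (LinearMap.ker (LinearMap.toSpanSingleton R M g)) b
    ⟨a, 1 - a * b, by simp [sub_smul, mul_smul, hb, ha], by simp⟩
  refine ⟨u, ?_⟩
  rw [LinearMap.mem_ker, LinearMap.toSpanSingleton_apply] at hj
  rw [Units.smul_def, hu, add_smul, hb, hj, add_zero]

/-! ### Fourier analysis on a finite abelian group -/

/-- The character sum of `S` at `c`, i.e. an eigenvalue of the Cayley graph of `S`. -/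
noncomputable def charSum {A : Type*} [AddCommGroup A] (S : Finset (AddChar A ℂ)) (c : A) : ℂ :=
  ∑ ψ ∈ S, ψ c

section Duality

variable {A : Type*} [AddCommGroup A] [Fintype A]

theorem sum_apply_eq_ite_card (ψ : AddChar A ℂ) :
    ∑ c, ψ c = if ψ = 0 then (Fintype.card A : ℂ) else 0 := by
  classical
  exact AddChar.sum_eq_ite ψ

/-- Fourier inversion: orthogonality of characters recovers the indicator function of `S`. -/
theorem sum_mul_charSum (S : Finset (AddChar A ℂ)) (ψ : AddChar A ℂ) :
    ∑ c, ψ (-c) * charSum S c = if ψ ∈ S then (Fintype.card A : ℂ) else 0 := by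
  have h : ∀ φ : AddChar A ℂ, ∑ c, ψ (-c) * φ c = if φ = ψ then (Fintype.card A : ℂ) else 0 := by
    intro φ
    have := sum_apply_eq_ite_card (φ - ψ)
    simp only [sub_eq_zero, AddChar.sub_apply] at this
    rw [← this]
    exact Finset.sum_congr rfl fun c _ => mul_comm _ _
  simp only [charSum, Finset.mul_sum]
  rw [Finset.sum_comm, Finset.sum_congr rfl fun φ _ => h φ]
  simp [Finset.sum_ite_eq']

/-- The square of a transform is the transform of a convolution, so its coefficients count
representations as a sum of two elements of `S`. -/
theorem sum_mul_charSum_sq (S : Finset (AddChar A ℂ)) (ψ : AddChar A ℂ) :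
    ∑ c, ψ (-c) * charSum S c ^ 2 =
      (Fintype.card A : ℂ) * ((S.filter fun φ => ψ - φ ∈ S).card : ℂ) := by
  have h : ∀ φ : AddChar A ℂ, ∑ c, ψ (-c) * (φ c * charSum S c) =
      if ψ - φ ∈ S then (Fintype.card A : ℂ) else 0 := by
    intro φ
    rw [← sum_mul_charSum]
    refine Finset.sum_congr rfl fun c _ => ?_
    rw [AddChar.sub_apply, neg_neg, mul_assoc]
  have h2 : ∀ c, ψ (-c) * charSum S c ^ 2 = ∑ φ ∈ S, ψ (-c) * (φ c * charSum S c) := by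
    intro c
    rw [← Finset.mul_sum, ← Finset.sum_mul, sq]; rfl
  simp only [h2]
  rw [Finset.sum_comm, Finset.sum_congr rfl fun φ _ => h φ, ← Finset.sum_filter,
    Finset.sum_const, nsmul_eq_mul, mul_comm]

/-- The sum over a finite set that is a subgroup. -/
theorem sum_subgroup_apply {G : Type*} [AddCommGroup G] (H : AddSubgroup G) (s : Finset G)
    (hs : ∀ x, x ∈ H ↔ x ∈ s) (φ : AddChar G ℂ) :
    (∑ x ∈ s, φ x = s.card ∧ ∀ x ∈ s, φ x = 1) ∨ (∑ x ∈ s, φ x = 0 ∧ ∃ x ∈ s, φ x ≠ 1) := by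
  by_cases h : ∀ x ∈ s, φ x = 1
  · left
    refine ⟨?_, h⟩
    rw [Finset.sum_congr rfl h]; simp
  · right
    push Not at h
    refine ⟨?_, h⟩
    obtain ⟨y, hy, hy1⟩ := h
    have h1 : φ y * ∑ x ∈ s, φ x = ∑ x ∈ s, φ x := by
      rw [Finset.mul_sum]
      refine Finset.sum_bij (fun x _ => y + x) ?_ ?_ ?_ ?_
      · intro x hx
        exact (hs _).1 (H.add_mem ((hs _).2 hy) ((hs _).2 hx))
      · intro a _ b _ hab; exact add_left_cancel hab
      · intro b hb
        refine ⟨-y + b, (hs _).1 (H.add_mem (H.neg_mem ((hs _).2 hy)) ((hs _).2 hb)), by abel⟩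
      · intro x _; rw [AddChar.map_add_eq_mul]
    have h2 : (φ y - 1) * ∑ x ∈ s, φ x = 0 := by rw [sub_mul, h1, one_mul, sub_self]
    exact (mul_eq_zero.1 h2).resolve_left (sub_ne_zero.2 hy1)

/-- The characters that are trivial on a set form a subgroup. -/
def annihilator (X : Set A) : AddSubgroup (AddChar A ℂ) where
  carrier := {ψ | ∀ c ∈ X, ψ c = 1}
  zero_mem' := fun c _ => by simp
  add_mem' := fun {a b} ha hb c hc => by rw [AddChar.add_apply, ha c hc, hb c hc, one_mul]
  neg_mem' := fun {a} ha c hc => by rw [AddChar.neg_apply', ha c hc, inv_one]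

/-- The elements on which a set of characters is trivial form a subgroup. -/
def coannihilator (X : Set (AddChar A ℂ)) : AddSubgroup A where
  carrier := {c | ∀ ψ ∈ X, ψ c = 1}
  zero_mem' := fun c _ => by simp
  add_mem' := fun {a b} ha hb c hc => by rw [AddChar.map_add_eq_mul, ha c hc, hb c hc, one_mul]
  neg_mem' := fun {a} ha c hc => by rw [AddChar.map_neg_eq_inv, ha c hc, inv_one]

/-- A sum of character values equals the number of summands only if all values are `1`. -/
theorem forall_eq_one_of_sum_eq_card (ψ : AddChar A ℂ) (s : Finset A)
    (h : ∑ c ∈ s, ψ c = s.card) : ∀ c ∈ s, ψ c = 1 := by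
  -- Character values lie on the unit circle, so a sum attains the number of terms only if each real
  -- part is `1`.
  have hre : ∀ c, (ψ c).re ≤ 1 := fun c => (Complex.re_le_norm _).trans (ψ.norm_apply c).le
  have hs : ∑ c ∈ s, (1 - (ψ c).re) = 0 := by
    rw [Finset.sum_sub_distrib, ← Complex.re_sum, h]; simp
  intro c hc
  have h1 := (Finset.sum_eq_zero_iff_of_nonneg fun c _ => sub_nonneg.2 (hre c)).1 hs c hc
  have h2 : (ψ c).re = 1 := by linarith
  have h3 := ψ.norm_apply c
  have h4 : (ψ c).re ^ 2 + (ψ c).im ^ 2 = 1 := by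
    have := Complex.sq_norm (ψ c)
    rw [h3, Complex.normSq_apply] at this
    nlinarith
  apply Complex.ext
  · simpa using h2
  · rw [h2] at h4
    have : (ψ c).im ^ 2 = 0 := by linarith
    simpa using this

end Duality

/-! ### Two-valued weights and their connection sets -/

/-- A set `S` of characters of a finite abelian group `A`, together with a two-valued weight on `A`
that is an affine function of the character sums of `S`. -/
structure IsTwoWeightConnectionSet {A : Type*} [AddCommGroup A] (S : Finset (AddChar A ℂ))
    (wt : A → ℝ) (n r w₁ w₂ : ℝ) : Prop where
  zero_notMem : (0 : AddChar A ℂ) ∉ S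
  neg_mem : ∀ ψ ∈ S, -ψ ∈ S
  wt_eq : ∀ c, ((wt c : ℝ) : ℂ) = n - r * charSum S c
  wt_zero : wt 0 = 0
  wt_ne_zero : ∀ c, c ≠ 0 → wt c = w₁ ∨ wt c = w₂
  exists_fst : ∃ c, wt c = w₁
  exists_snd : ∃ c, wt c = w₂
  pos : 0 < w₁
  lt : w₁ < w₂
  r_pos : 0 < r

namespace IsTwoWeightConnectionSet

open scoped Classical in
/-- The elements of weight `w₁`. -/
noncomputable def fst {A : Type*} [Fintype A] (wt : A → ℝ) (w₁ : ℝ) : Finset A :=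
  Finset.univ.filter fun c => wt c = w₁

@[simp] theorem mem_fst {A : Type*} [Fintype A] {wt : A → ℝ} {w₁ : ℝ} {c : A} :
    c ∈ fst wt w₁ ↔ wt c = w₁ := by simp [fst]

variable {A : Type*} [AddCommGroup A] {S : Finset (AddChar A ℂ)}
  {wt : A → ℝ} {n r w₁ w₂ : ℝ} (h : IsTwoWeightConnectionSet S wt n r w₁ w₂)

include h

/-- Evaluation at `0`, where all characters are `1`; this is the valency `K' = n / r`. -/
theorem length_eq : n = r * S.card := by
  have h0 := h.wt_eq 0
  rw [h.wt_zero] at h0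
  simp only [charSum, AddChar.map_zero_eq_one, Finset.sum_const, nsmul_eq_mul, mul_one] at h0
  have : ((n - r * S.card : ℝ) : ℂ) = 0 := by push_cast; rw [← h0]; simp
  have := Complex.ofReal_eq_zero.1 this
  linarith

theorem charSum_eq (c : A) : charSum S c = ((n - wt c) / r : ℝ) := by
  have hr : (r : ℂ) ≠ 0 := by exact_mod_cast h.r_pos.ne'
  push_cast
  rw [h.wt_eq c]; field_simp; ring

theorem snd_pos : 0 < w₂ := h.pos.trans h.lt

theorem wt_eq_zero {c : A} : wt c = 0 ↔ c = 0 := by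
  refine ⟨fun hc => ?_, fun hc => hc ▸ h.wt_zero⟩
  by_contra hne
  have := h.pos; have := h.lt
  rcases h.wt_ne_zero c hne with h1 | h1 <;> linarith

/-- The nonzero weights do not all agree if they include both values. -/
theorem not_forall_wt_eq (w : ℝ) (hw : ∀ c, c ≠ 0 → wt c = w) : False := by
  obtain ⟨a, ha⟩ := h.exists_fst
  obtain ⟨b, hb⟩ := h.exists_snd
  have ha0 : a ≠ 0 := fun h0 => by have := h.pos; rw [← ha, h0, h.wt_zero] at this; linarith
  have hb0 : b ≠ 0 := fun h0 => by have := h.snd_pos; rw [← hb, h0, h.wt_zero] at this; linarith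
  have := h.lt
  rw [← ha, ← hb, hw a ha0, hw b hb0] at this
  exact lt_irrefl _ this

/-- `S ∪ {0}` is not a subgroup. -/
theorem not_subgroup (H : AddSubgroup (AddChar A ℂ)) : ¬ ∀ ψ, ψ ∈ H ↔ ψ = 0 ∨ ψ ∈ S := by
  intro hH
  classical
  -- The sum over `S ∪ {0}` is `1 + (n - wt c) / r`. The full value forces `c = 0`, and the value
  -- `0` forces `wt c = n + r`, leaving a single nonzero weight.
  refine h.not_forall_wt_eq (n + r) fun c hc => ?_
  have hs := sum_subgroup_apply H (insert 0 S) (fun x => by rw [hH]; simp)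
    (AddChar.doubleDualEmb c)
  simp only [Finset.sum_insert h.zero_notMem, AddChar.doubleDualEmb_apply, AddChar.zero_apply,
    Finset.card_insert_of_notMem h.zero_notMem] at hs
  change ((1 + charSum S c = _) ∧ _) ∨ ((1 + charSum S c = _) ∧ _) at hs
  rw [h.charSum_eq c] at hs
  have hr := h.r_pos
  rcases hs with ⟨hs, -⟩ | ⟨hs, -⟩
  · have h1 : 1 + (n - wt c) / r = S.card + 1 := by exact_mod_cast hs
    have h2 : (n - wt c) / r = S.card := by linarith
    rw [div_eq_iff hr.ne', mul_comm, ← h.length_eq] at h2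
    exact absurd (h.wt_eq_zero.1 (by linarith)) hc
  · have h1 : 1 + (n - wt c) / r = 0 := by exact_mod_cast hs
    have h2 : (n - wt c) / r = -1 := by linarith
    rw [div_eq_iff hr.ne'] at h2
    linarith

variable [Fintype A]

/-- Since `n - wt` is `r` times the transform of `S`, inverting it determines the transform of `C₁`.
This is why the dual code has only two nonzero weights. -/
theorem sum_fst_mul {ψ : AddChar A ℂ} (hψ : ψ ≠ 0) :
    (∑ c ∈ fst wt w₁, ψ c) * (w₂ - w₁) =
      (if ψ ∈ S then (r * Fintype.card A : ℂ) else 0) - w₂ := by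
  classical
  have h1 : ∑ c, ψ c * ((n : ℂ) - wt c) = if ψ ∈ S then (r * Fintype.card A : ℂ) else 0 := by
    have h2 := sum_mul_charSum S (-ψ)
    have h3 : -ψ ∈ S ↔ ψ ∈ S := ⟨fun hh => by simpa using h.neg_mem _ hh, h.neg_mem _⟩
    simp only [AddChar.neg_apply, neg_neg, h3] at h2
    rw [← mul_ite_zero, ← h2, Finset.mul_sum]
    refine Finset.sum_congr rfl fun c _ => ?_
    rw [h.wt_eq c]; ring
  -- The function `n - wt` is the constant `n - w₂`, plus `w₂ - w₁` on `C₁`, plus `w₂` at the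
  -- origin.
  have h4 : ∀ c, ψ c * ((n : ℂ) - wt c) = (n - w₂) * ψ c
      + ((w₂ - w₁) * (if c ∈ fst wt w₁ then ψ c else 0) + (if c = 0 then (w₂ : ℂ) else 0)) := by
    intro c
    have hp := h.pos
    have hlt := h.lt
    by_cases hc : c = 0
    · subst hc
      simp [h.wt_zero, hp.ne]
    · rcases h.wt_ne_zero c hc with hw | hw
      · simp [hw, hc]; ring
      · simp [hw, hc, hlt.ne']; ring
  simp only [h4] at h1
  rw [Finset.sum_add_distrib, ← Finset.mul_sum, sum_apply_eq_ite_card, if_neg hψ,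
    Finset.sum_add_distrib, ← Finset.mul_sum, Finset.sum_ite_eq' , ← Finset.sum_filter] at h1
  rw [← h1, Finset.filter_univ_mem]
  simp
  ring

theorem sum_fst_of_mem {ψ : AddChar A ℂ} (hψ : ψ ∈ S) :
    ∑ c ∈ fst wt w₁, ψ c = ((r * Fintype.card A - w₂) / (w₂ - w₁) : ℝ) := by
  have hne : ((w₂ : ℂ) - w₁) ≠ 0 := by exact_mod_cast (sub_pos.2 h.lt).ne'
  have := h.sum_fst_mul (ψ := ψ) (fun h0 => h.zero_notMem (h0 ▸ hψ))
  rw [if_pos hψ] at this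
  push_cast
  rw [eq_div_iff hne, this]

theorem sum_fst_of_notMem {ψ : AddChar A ℂ} (h0 : ψ ≠ 0) (hψ : ψ ∉ S) :
    ∑ c ∈ fst wt w₁, ψ c = (- w₂ / (w₂ - w₁) : ℝ) := by
  have hne : ((w₂ : ℂ) - w₁) ≠ 0 := by exact_mod_cast (sub_pos.2 h.lt).ne'
  have := h.sum_fst_mul h0
  rw [if_neg hψ, zero_sub] at this
  push_cast
  rw [eq_div_iff hne, this]

/-- Otherwise `S ∪ {0}` would be the whole group. Hence the larger dual weight is attained. -/
theorem exists_notMem : ∃ ψ : AddChar A ℂ, ψ ≠ 0 ∧ ψ ∉ S := by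
  by_contra! hall
  refine h.not_subgroup ⊤ fun ψ => ?_
  have := hall ψ
  simp only [AddSubgroup.mem_top, true_iff]
  tauto

theorem exists_mem : ∃ ψ : AddChar A ℂ, ψ ∈ S := by
  by_contra! hall
  refine h.not_subgroup ⊥ fun ψ => ?_
  simp [hall ψ]

/-- The two sums differ by `r |A| / (w₂ - w₁)`. A larger sum means a smaller dual weight, so `S`
belongs to `w₁'`. -/
theorem sum_fst_lt : (- w₂ / (w₂ - w₁) : ℝ) < (r * Fintype.card A - w₂) / (w₂ - w₁) := by
  have := h.lt
  have hN : (0 : ℝ) < Fintype.card A := by exact_mod_cast Fintype.card_pos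
  apply div_lt_div_of_pos_right _ (by linarith)
  have := mul_pos h.r_pos hN
  linarith

/-- A nontrivial character has sum less than `|C₁|` over the words of weight `w₁`. -/
theorem sum_fst_ne_card {ψ : AddChar A ℂ} (h0 : ψ ≠ 0) :
    ∑ c ∈ fst wt w₁, ψ c ≠ (fst wt w₁).card := by
  intro heq
  have hlt := h.sum_fst_lt
  have hsp := h.snd_pos
  have hl := h.lt
  have hneg : (- w₂ / (w₂ - w₁) : ℝ) < 0 := div_neg_of_neg_of_pos (by linarith) (by linarith)
  have hnot : ∀ φ : AddChar A ℂ, φ ≠ 0 → φ ∉ S →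
      ∑ c ∈ fst wt w₁, φ c ≠ (fst wt w₁).card := by
    intro φ hφ0 hφ h1
    rw [h.sum_fst_of_notMem hφ0 hφ] at h1
    have h2 : (- w₂ / (w₂ - w₁) : ℝ) = (fst wt w₁).card := by exact_mod_cast h1
    have : (0 : ℝ) ≤ (fst wt w₁).card := Nat.cast_nonneg _
    linarith
  have hmem : ψ ∈ S := by
    by_contra hψ
    exact hnot ψ h0 hψ heq
  -- The sum is constant on `S`. If one element of `S` were trivial on `C₁`, all would be, and `S ∪
  -- {0}` would be the annihilator of `C₁`.
  refine h.not_subgroup (annihilator (fst wt w₁ : Set A)) fun φ => ?_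
  constructor
  · intro hφ
    by_contra! hc
    refine hnot φ hc.1 hc.2 ?_
    rw [Finset.sum_congr rfl fun c hc => hφ c (by simpa using hc)]
    simp
  · rintro (rfl | hφ)
    · exact AddSubgroup.zero_mem _
    · intro c hc
      refine forall_eq_one_of_sum_eq_card φ _ ?_ c hc
      rw [h.sum_fst_of_mem hφ, ← h.sum_fst_of_mem hmem, heq]

/-- The number of ways to write a nontrivial character as a sum of two elements of `S`. -/
theorem card_filter_sub_mem {ψ : AddChar A ℂ} (h0 : ψ ≠ 0) :
    ((S.filter fun φ => ψ - φ ∈ S).card : ℝ) =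
      (if ψ ∈ S then (2 * n - w₁ - w₂) / r else 0) + w₁ * w₂ / (r ^ 2 * Fintype.card A) := by
  classical
  have hr := h.r_pos.ne'
  have hN : (Fintype.card A : ℝ) ≠ 0 := by exact_mod_cast Fintype.card_ne_zero
  -- For `c ≠ 0` the character sum is a root of the quadratic with roots `(n - w₁) / r` and `(n -
  -- w₂) / r`. At `c = 0` its value `n / r` leaves the defect `w₁ w₂ / r²`.
  have hsq : ∀ c, ψ (-c) * charSum S c ^ 2 =
      (((2 * n - w₁ - w₂) / r : ℝ) : ℂ) * (ψ (-c) * charSum S c)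
      + ((-((n - w₁) * (n - w₂) / r ^ 2) : ℝ) * (-ψ) c
      + (if c = 0 then ((w₁ * w₂ / r ^ 2 : ℝ) : ℂ) else 0)) := by
    intro c
    rw [h.charSum_eq, AddChar.neg_apply]
    by_cases hc : c = 0
    · subst hc
      rw [h.wt_zero, if_pos rfl, neg_zero, AddChar.map_zero_eq_one]
      norm_cast
      field_simp
      ring
    · rw [if_neg hc, add_zero]
      rw [mul_left_comm, mul_comm _ (ψ (-c)), ← mul_add]
      congr 1
      norm_cast
      rcases h.wt_ne_zero c hc with hw | hw <;> rw [hw] <;> field_simp <;> ring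
  have h1 := sum_mul_charSum_sq S ψ
  simp only [hsq] at h1
  rw [Finset.sum_add_distrib, ← Finset.mul_sum, sum_mul_charSum, Finset.sum_add_distrib,
    ← Finset.mul_sum, sum_apply_eq_ite_card, if_neg (neg_ne_zero.2 h0),
    Finset.sum_ite_eq' ] at h1
  simp only [Finset.mem_univ, if_true, mul_zero, zero_add] at h1
  have h2 : (Fintype.card A : ℝ) * ((S.filter fun φ => ψ - φ ∈ S).card : ℝ) =
      (2 * n - w₁ - w₂) / r * (if ψ ∈ S then (Fintype.card A : ℝ) else 0) + w₁ * w₂ / r ^ 2 := by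
    have : (if ψ ∈ S then (Fintype.card A : ℂ) else 0) =
        ((if ψ ∈ S then (Fintype.card A : ℝ) else 0 : ℝ) : ℂ) := by split_ifs <;> simp
    rw [this] at h1
    exact_mod_cast h1.symm
  apply mul_left_cancel₀ hN
  rw [h2]
  split_ifs <;> field_simp
  ring

/-- The complement of `S` is a subgroup iff `w₁ = n`. -/
theorem compl_subgroup_iff :
    (∃ H : AddSubgroup (AddChar A ℂ), ∀ ψ, ψ ∈ H ↔ ψ ∉ S) ↔ w₁ = n := by
  classical
  have hr := h.r_pos
  constructor
  · rintro ⟨H, hH⟩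
    -- For `c ≠ 0` the sum over the complement is `-(n - wt c) / r`, which is `0` or the order of
    -- `H`. As no nonzero element has weight below `n`, the value `n` could only be `w₁`.
    have key : ∀ c, c ≠ 0 → n ≤ wt c ∧ (wt c = n ∨ wt c = n + r * (Sᶜ).card) := by
      intro c hc
      have hs := sum_subgroup_apply H Sᶜ (fun x => by rw [hH]; simp) (AddChar.doubleDualEmb c)
      simp only [AddChar.doubleDualEmb_apply] at hs
      have hcompl : ∑ ψ ∈ Sᶜ, ψ c = -charSum S c := by
        have h1 := Finset.sum_add_sum_compl S (fun ψ : AddChar A ℂ => ψ c)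
        rw [AddChar.sum_apply_eq_ite, if_neg hc] at h1
        exact (neg_eq_of_add_eq_zero_right h1).symm
      rw [hcompl, h.charSum_eq] at hs
      have hpos : 0 ≤ r * ((Sᶜ).card : ℝ) := by positivity
      rcases hs with ⟨hs, -⟩ | ⟨hs, -⟩
      · have h1 : -((n - wt c) / r) = (Sᶜ).card := by exact_mod_cast hs
        rw [← neg_div, div_eq_iff hr.ne'] at h1
        exact ⟨by linarith, Or.inr (by linarith)⟩
      · have h1 : -((n - wt c) / r) = 0 := by exact_mod_cast hs
        rw [← neg_div, div_eq_iff hr.ne'] at h1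
        exact ⟨by linarith, Or.inl (by linarith)⟩
    obtain ⟨a, ha⟩ := h.exists_fst
    by_contra hne
    have hw : ∀ c, c ≠ 0 → wt c = n + r * (Sᶜ).card := by
      intro c hc
      have hp := h.pos
      have hl := h.lt
      obtain ⟨h1, h2⟩ := key c hc
      obtain ⟨h3, h4⟩ := key a (fun h0 => by rw [h0, h.wt_zero] at ha; linarith)
      rcases h2 with h2 | h2
      · exfalso
        rcases h.wt_ne_zero c hc with h5 | h5
        · exact hne (h5 ▸ h2)
        · linarith
      · exact h2
    exact h.not_forall_wt_eq _ hw
  · intro hw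
    -- With `w₁ = n` one root of the quadratic is `0`. Its coefficient at the trivial character
    -- counts all of `S`, because `S = -S`, so `μ'` equals the valency.
    have hμ : w₁ * w₂ / (r ^ 2 * Fintype.card A) = (S.card : ℝ) := by
      have h1 := sum_mul_charSum_sq S 0
      have h3 : (S.filter fun φ => (0 : AddChar A ℂ) - φ ∈ S) = S := by
        refine Finset.filter_true_of_mem fun φ hφ => ?_
        rw [zero_sub]; exact h.neg_mem φ hφ
      have h2 := sum_mul_charSum S 0
      rw [h3] at h1
      rw [if_neg h.zero_notMem] at h2
      have hN : (Fintype.card A : ℝ) ≠ 0 := by exact_mod_cast Fintype.card_ne_zero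
      have hsq : ∀ c, (0 : AddChar A ℂ) (-c) * charSum S c ^ 2 =
          (((n - w₂) / r : ℝ) : ℂ) * ((0 : AddChar A ℂ) (-c) * charSum S c)
          + (if c = 0 then ((w₁ * w₂ / r ^ 2 : ℝ) : ℂ) else 0) := by
        intro c
        rw [h.charSum_eq, AddChar.zero_apply]
        by_cases hc : c = 0
        · subst hc
          rw [h.wt_zero, if_pos rfl, hw]
          norm_cast
          field_simp
          ring
        · rw [if_neg hc, add_zero]
          norm_cast
          rcases h.wt_ne_zero c hc with hw' | hw' <;> rw [hw'] <;> try rw [hw]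
          · simp
          · field_simp
      simp only [hsq] at h1
      rw [Finset.sum_add_distrib, ← Finset.mul_sum, h2, Finset.sum_ite_eq'] at h1
      simp only [Finset.mem_univ, if_true, mul_zero, zero_add] at h1
      have h4 : w₁ * w₂ / r ^ 2 = Fintype.card A * S.card := by exact_mod_cast h1
      rw [← div_div, h4, mul_div_cancel_left₀ _ hN]
    -- Since `μ' = |S|`, a character outside `S` has all of `S` as common neighbours with `0`. This
    -- makes the complement closed under addition.
    have hstab : ∀ ψ, ψ ∉ S → ∀ φ ∈ S, ψ - φ ∈ S := by
      intro ψ hψ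
      by_cases h0 : ψ = 0
      · intro φ hφ; rw [h0, zero_sub]; exact h.neg_mem φ hφ
      · have h1 := h.card_filter_sub_mem h0
        rw [if_neg hψ, zero_add, hμ] at h1
        exact fun φ hφ => Finset.card_filter_eq_iff.1 (by exact_mod_cast h1) φ hφ
    refine ⟨{ carrier := {ψ | ψ ∉ S}, zero_mem' := h.zero_notMem, add_mem' := ?_,
              neg_mem' := ?_ }, fun ψ => Iff.rfl⟩
    · intro a b ha hb hab
      have h1 := hstab a ha _ hab
      rw [sub_add_cancel_left] at h1
      exact hb (by simpa using h.neg_mem _ h1)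
    · intro a ha hna
      exact ha (by simpa using h.neg_mem _ hna)

/-- `C₁ ∪ {0}` is not a subgroup. -/
theorem not_subgroup_fst (H : AddSubgroup A) : ¬ ∀ c, c ∈ H ↔ c = 0 ∨ wt c = w₁ := by
  intro hH
  classical
  obtain ⟨ψ, h0, hψ⟩ := h.exists_notMem
  have hz : (0 : A) ∉ fst wt w₁ := by
    rw [mem_fst, h.wt_zero]; exact h.pos.ne
  have hs := sum_subgroup_apply H (insert 0 (fst wt w₁)) (fun x => by rw [hH]; simp) ψ
  rw [Finset.sum_insert hz, h.sum_fst_of_notMem h0 hψ, AddChar.map_zero_eq_one] at hs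
  have hp := h.pos
  have hl := h.lt
  -- As `w₁ > 0`, the sum over `C₁ ∪ {0}` is negative, so it is neither `0` nor a cardinality.
  have hlt : (- w₂ / (w₂ - w₁) : ℝ) < -1 := by
    rw [div_lt_iff₀ (by linarith)]; linarith
  rcases hs with ⟨hs, -⟩ | ⟨hs, -⟩
  · have h1 : 1 + (- w₂ / (w₂ - w₁) : ℝ) = (insert 0 (fst wt w₁)).card := by exact_mod_cast hs
    have : (0 : ℝ) ≤ (insert 0 (fst wt w₁)).card := Nat.cast_nonneg _
    linarith
  · have h1 : 1 + (- w₂ / (w₂ - w₁) : ℝ) = 0 := by exact_mod_cast hs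
    linarith

/-- The complement of `C₁` is a subgroup iff `w₁ = n`. -/
theorem compl_subgroup_fst_iff :
    (∃ H : AddSubgroup A, ∀ c, c ∈ H ↔ wt c ≠ w₁) ↔ w₁ = n := by
  classical
  have hp := h.pos
  have hl := h.lt
  have hr := h.r_pos
  rw [← h.compl_subgroup_iff]
  constructor
  · rintro ⟨H, hH⟩
    have hH' : ∀ x, x ∈ H ↔ x ∈ (fst wt w₁)ᶜ := fun x => by rw [hH]; simp
    have hcompl : ∀ ψ : AddChar A ℂ, ψ ≠ 0 →
        ∑ c ∈ (fst wt w₁)ᶜ, ψ c = -∑ c ∈ fst wt w₁, ψ c := by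
      intro ψ h0
      have h1 := Finset.sum_add_sum_compl (fst wt w₁) (fun c => ψ c)
      rw [sum_apply_eq_ite_card, if_neg h0] at h1
      exact (neg_eq_of_add_eq_zero_right h1).symm
    have hlt := h.sum_fst_lt
    have hneg : (- w₂ / (w₂ - w₁) : ℝ) < 0 :=
      div_neg_of_neg_of_pos (by linarith) (by linarith)
    obtain ⟨ψ₀, h0₀, hψ₀⟩ := h.exists_notMem
    have hout : ∀ ψ : AddChar A ℂ, ψ ≠ 0 → ψ ∉ S →
        ((w₂ / (w₂ - w₁) : ℝ) = ((fst wt w₁)ᶜ).card ∧ ∀ x ∈ (fst wt w₁)ᶜ, ψ x = 1) := by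
      intro ψ h0 hψ
      have hs := sum_subgroup_apply H _ hH' ψ
      rw [hcompl ψ h0, h.sum_fst_of_notMem h0 hψ] at hs
      rcases hs with ⟨hs, hx⟩ | ⟨hs, -⟩
      · have h1 : -(- w₂ / (w₂ - w₁) : ℝ) = ((fst wt w₁)ᶜ).card := by exact_mod_cast hs
        exact ⟨by rw [← h1, neg_div, neg_neg], hx⟩
      · have h1 : -(- w₂ / (w₂ - w₁) : ℝ) = 0 := by exact_mod_cast hs
        linarith
    -- The complement of `S` is the annihilator of `H`: outside `S ∪ {0}` the sum over `H` is
    -- nonzero, hence equal to `|H|`, while on `S` it is smaller.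
    refine ⟨annihilator (H : Set A), fun ψ => ⟨fun hψ hS => ?_, fun hψ c hc => ?_⟩⟩
    · have h0 : ψ ≠ 0 := fun h0 => h.zero_notMem (h0 ▸ hS)
      have h1 : ∑ c ∈ (fst wt w₁)ᶜ, ψ c = ((fst wt w₁)ᶜ).card := by
        rw [Finset.sum_congr rfl fun c hc => hψ c ((hH' c).2 hc)]; simp
      rw [hcompl ψ h0, h.sum_fst_of_mem hS] at h1
      have h2 : -((r * Fintype.card A - w₂) / (w₂ - w₁)) = (((fst wt w₁)ᶜ).card : ℝ) := by
        exact_mod_cast h1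
      rw [← (hout ψ₀ h0₀ hψ₀).1] at h2
      rw [neg_div] at hlt
      linarith
    · by_cases h0 : ψ = 0
      · rw [h0, AddChar.zero_apply]
      · exact (hout ψ h0 hψ).2 c ((hH' c).1 hc)
  · rintro ⟨H, hH⟩
    have hw : w₁ = n := h.compl_subgroup_iff.1 ⟨H, hH⟩
    have hH' : ∀ x, x ∈ H ↔ x ∈ Sᶜ := fun x => by rw [hH]; simp
    -- For `c ≠ 0` the sum over `H` vanishes exactly when `wt c = n = w₁`, and otherwise `c` is
    -- killed by all of `H`.
    refine ⟨coannihilator (H : Set (AddChar A ℂ)), fun c => ?_⟩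
    by_cases hc : c = 0
    · subst hc
      rw [h.wt_zero]
      exact iff_of_true (AddSubgroup.zero_mem _) hp.ne
    have hs := sum_subgroup_apply H Sᶜ hH' (AddChar.doubleDualEmb c)
    simp only [AddChar.doubleDualEmb_apply] at hs
    have hcompl : ∑ ψ ∈ Sᶜ, ψ c = -charSum S c := by
      have h1 := Finset.sum_add_sum_compl S (fun ψ : AddChar A ℂ => ψ c)
      rw [AddChar.sum_apply_eq_ite, if_neg hc] at h1
      exact (neg_eq_of_add_eq_zero_right h1).symm
    rw [hcompl, h.charSum_eq] at hs
    have hcard : (0 : ℝ) < (Sᶜ).card := by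
      exact_mod_cast Finset.card_pos.2 ⟨0, by simpa using h.zero_notMem⟩
    rcases hs with ⟨hs, hx⟩ | ⟨hs, x, hx, hx1⟩
    · refine iff_of_true (fun ψ hψ => hx ψ ((hH' ψ).1 hψ)) fun hcw => ?_
      have h1 : -((n - wt c) / r) = (Sᶜ).card := by exact_mod_cast hs
      rw [hcw, hw, sub_self, zero_div, neg_zero] at h1
      linarith
    · refine iff_of_false (fun hcm => hx1 (hcm x ((hH' x).2 hx))) fun hcw => ?_
      have h1 : -((n - wt c) / r) = 0 := by exact_mod_cast hs
      rw [← neg_div, div_eq_iff hr.ne'] at h1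
      exact hcw (by linarith)

end IsTwoWeightConnectionSet

/-! ### Cayley graphs: triviality and strong regularity -/

section Cayley

variable {V G : Type*} [AddCommGroup G] {Γ : SimpleGraph V} (e : V ≃ G) {T : Set G}

/-- The clique of the origin is the subgroup; conversely, the cliques are the cosets of `H`. -/
theorem isUnionOfEqualCliques_iff (hadj : ∀ v w, Γ.Adj v w ↔ e w - e v ∈ T) :
    IsUnionOfEqualCliques Γ ↔ ∃ H : AddSubgroup G, ∀ x, x ∈ H ↔ x = 0 ∨ x ∈ T := by
  constructor
  · rintro ⟨s, hs, -⟩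
    have key : ∀ x y, s (e.symm x) (e.symm y) ↔ y - x = 0 ∨ y - x ∈ T := by
      intro x y
      have h1 := hs (e.symm x) (e.symm y)
      rw [hadj, e.apply_symm_apply, e.apply_symm_apply] at h1
      rw [h1, sub_eq_zero]
      by_cases hxy : y = x
      · subst hxy; simp
      · have : e.symm x ≠ e.symm y := fun hh => hxy (e.symm.injective hh).symm
        simp [hxy, this]
    have key0 : ∀ y, s (e.symm 0) (e.symm y) ↔ y = 0 ∨ y ∈ T := fun y => by simpa using key 0 y
    refine ⟨{ carrier := {x | s (e.symm 0) (e.symm x)}, zero_mem' := s.refl _, add_mem' := ?_,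
              neg_mem' := ?_ }, key0⟩
    · intro a b ha hb
      refine s.trans ha ((key _ _).2 ?_)
      rw [add_sub_cancel_left]
      exact (key0 b).1 hb
    · intro a ha
      have h1 := (key _ _).1 (s.symm ha)
      rw [zero_sub] at h1
      exact (key0 _).2 h1
  · rintro ⟨H, hH⟩
    refine ⟨⟨fun v w => e w - e v ∈ H, fun v => by simp, fun {v w} h => ?_,
      fun {u v w} h1 h2 => ?_⟩, fun v w => ?_, fun v w => ?_⟩
    · simpa using H.neg_mem h
    · simpa using H.add_mem h2 h1
    · change _ ↔ v ≠ w ∧ e w - e v ∈ H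
      rw [hH, sub_eq_zero, ← hadj, e.apply_eq_iff_eq]
      refine ⟨fun h => ⟨h.ne, Or.inr h⟩, fun h => h.2.resolve_left fun hh => h.1 hh.symm⟩
    · have h1 : ∀ v, {x | e x - e v ∈ H}.ncard = (H : Set G).ncard := by
        intro v
        refine Set.ncard_congr (fun x _ => e x - e v) (fun x hx => hx) ?_ ?_
        · intro a b _ _ hab
          exact e.injective (sub_left_injective hab)
        · intro b hb
          exact ⟨e.symm (b + e v), by simpa using hb, by simp⟩
      exact (h1 v).trans (h1 w).symm

theorem isTrivialGraph_iff (hadj : ∀ v w, Γ.Adj v w ↔ e w - e v ∈ T) :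
    IsTrivialGraph Γ ↔ (∃ H : AddSubgroup G, ∀ x, x ∈ H ↔ x = 0 ∨ x ∈ T) ∨
      ∃ H : AddSubgroup G, ∀ x, x ∈ H ↔ x ∉ T := by
  have h0 : (0 : G) ∉ T := by
    intro h0
    refine Γ.irrefl (v := e.symm 0) ((hadj _ _).2 ?_)
    simpa using h0
  have hc : ∀ v w, Γᶜ.Adj v w ↔ e w - e v ∈ {x | x ≠ 0 ∧ x ∉ T} := by
    intro v w
    rw [SimpleGraph.compl_adj, hadj, Set.mem_ofPred_eq, sub_ne_zero, ne_comm, e.injective.ne_iff]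
  rw [IsTrivialGraph, isUnionOfEqualCliques_iff e hadj, isUnionOfEqualCliques_iff e hc]
  refine or_congr_right (exists_congr fun H => forall_congr' fun x => ?_)
  have : x = 0 ∨ (x ≠ 0 ∧ x ∉ T) ↔ x ∉ T := by
    by_cases hx : x = 0
    · subst hx; simp [h0]
    · simp [hx]
  rw [Set.mem_ofPred_eq, this]

/-- Translation by `-e v` carries the common neighbours of `v` and `w` to the representations of `e
w - e v` as a sum of two elements of `T`. -/
theorem isStronglyRegular_of_forall [Finite V] (hadj : ∀ v w, Γ.Adj v w ↔ e w - e v ∈ T) {ℓ μ : ℕ}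
    (hℓ : ∀ x ∈ T, {y | y ∈ T ∧ x - y ∈ T}.ncard = ℓ)
    (hμ : ∀ x, x ≠ 0 → x ∉ T → {y | y ∈ T ∧ x - y ∈ T}.ncard = μ) :
    IsStronglyRegular Γ (Nat.card G) T.ncard ℓ μ := by
  have hcommon : ∀ v w, (Γ.commonNeighbors v w).ncard =
      {y | y ∈ T ∧ (e w - e v) - y ∈ T}.ncard := by
    intro v w
    refine Set.ncard_congr (fun x _ => e x - e v) ?_ ?_ ?_
    · intro x hx
      rw [SimpleGraph.mem_commonNeighbors] at hx
      refine ⟨(hadj _ _).1 hx.1, ?_⟩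
      rw [sub_sub_sub_cancel_right]
      exact (hadj _ _).1 hx.2.symm
    · intro a b _ _ hab
      exact e.injective (sub_left_injective hab)
    · rintro b ⟨hb, hb'⟩
      refine ⟨e.symm (b + e v), ?_, by simp⟩
      rw [SimpleGraph.mem_commonNeighbors]
      refine ⟨(hadj _ _).2 (by simpa using hb), ((hadj _ _).2 ?_).symm⟩
      rw [e.apply_symm_apply, add_comm, ← sub_sub]
      exact hb'
  have hdeg : ∀ v, (Γ.neighborSet v).ncard = T.ncard := by
    intro v
    refine Set.ncard_congr (fun x _ => e x - e v) (fun x hx => (hadj _ _).1 hx) ?_ ?_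
    · intro a b _ _ hab
      exact e.injective (sub_left_injective hab)
    · intro b hb
      exact ⟨e.symm (b + e v), (hadj _ _).2 (by simpa using hb), by simp⟩
  let : Fintype V := Fintype.ofFinite V
  let : DecidableRel Γ.Adj := Classical.decRel _
  change Γ.IsSRGWith _ _ _ _
  refine ⟨?_, fun v => ?_, fun v w hvw => ?_, fun v w hne hvw => ?_⟩
  · rw [← Nat.card_eq_fintype_card, Nat.card_congr e]
  · rw [← hdeg v, ← SimpleGraph.card_neighborSet_eq_degree, ← Nat.card_eq_fintype_card]; rfl
  · rw [← hℓ _ ((hadj _ _).1 hvw), ← hcommon, ← Nat.card_eq_fintype_card]; rfl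
  · rw [← hμ (e w - e v) (sub_ne_zero.2 (e.injective.ne hne.symm)) (fun h => hvw ((hadj _ _).2 h)),
      ← hcommon, ← Nat.card_eq_fintype_card]; rfl

end Cayley

/-! ### Left-right symmetry of generating characters -/

namespace IsGeneratingCharacter

variable {R : Type*} [Ring R] {χ : AddChar R ℂ} (hχ : IsGeneratingCharacter χ)

include hχ

theorem eq_zero_of_forall_mul_right {a : R} (h : ∀ x, χ (x * a) = 1) : a = 0 := by
  have h1 := hχ (Ideal.span {a}) fun x hx => by
    obtain ⟨y, rfl⟩ := Ideal.mem_span_singleton'.1 hx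
    exact h y
  exact Ideal.span_singleton_eq_bot.1 h1

variable [Finite R]

/-- Every additive character is of the form `x ↦ χ (x * a)`. -/
theorem exists_eq_mul_right (φ : AddChar R ℂ) : ∃ a, ∀ x, φ x = χ (x * a) := by
  have : Fintype R := Fintype.ofFinite R
  let f : R → AddChar R ℂ := fun a => χ.compAddMonoidHom (AddMonoidHom.mulRight a)
  have hf : Function.Injective f := by
    intro a b hab
    refine sub_eq_zero.1 (hχ.eq_zero_of_forall_mul_right fun x => ?_)
    have h1 : χ (x * a) = χ (x * b) := DFunLike.congr_fun hab x
    rw [mul_sub, AddChar.map_sub_eq_div, h1, div_self (χ.val_isUnit _).ne_zero]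
  obtain ⟨a, ha⟩ := ((Fintype.bijective_iff_injective_and_card f).2
    ⟨hf, AddChar.card_eq.symm⟩).2 φ
  exact ⟨a, fun x => by rw [← ha]; rfl⟩

/-- Every character is `x ↦ χ (x * b)`, so an `a` with `χ` trivial on `aR` is killed by all
characters. -/
theorem eq_zero_of_forall_mul_left {a : R} (h : ∀ x, χ (a * x) = 1) : a = 0 := by
  rw [← AddChar.forall_apply_eq_zero]
  intro φ
  obtain ⟨b, hb⟩ := hχ.exists_eq_mul_right φ
  rw [hb, h]

/-- Every additive character is of the form `x ↦ χ (a * x)`. -/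
theorem exists_eq_mul_left (φ : AddChar R ℂ) : ∃ a, ∀ x, φ x = χ (a * x) := by
  have : Fintype R := Fintype.ofFinite R
  let f : R → AddChar R ℂ := fun a => χ.compAddMonoidHom (AddMonoidHom.mulLeft a)
  have hf : Function.Injective f := by
    intro a b hab
    refine sub_eq_zero.1 (hχ.eq_zero_of_forall_mul_left fun x => ?_)
    have h1 : χ (a * x) = χ (b * x) := DFunLike.congr_fun hab x
    rw [sub_mul, AddChar.map_sub_eq_div, h1, div_self (χ.val_isUnit _).ne_zero]
  obtain ⟨a, ha⟩ := ((Fintype.bijective_iff_injective_and_card f).2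
    ⟨hf, AddChar.card_eq.symm⟩).2 φ
  exact ⟨a, fun x => by rw [← ha]; rfl⟩

/-- The Nakayama automorphism on units. -/
theorem exists_unit_mul_comm (u : Rˣ) : ∃ v : Rˣ, ∀ x, χ (x * u) = χ (v * x) := by
  obtain ⟨a, ha⟩ := hχ.exists_eq_mul_left (χ.compAddMonoidHom (AddMonoidHom.mulRight (u : R)))
  replace ha : ∀ x, χ (x * u) = χ (a * x) := ha
  -- If `a` kills `y - z` from the left, then `χ` is trivial on `(y - z)R`. Left multiplication by
  -- `a` is thus injective, which gives a right inverse and, by finiteness, a unit.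
  have hinj : Function.Injective fun y : R => a * y := by
    intro y z hyz
    refine sub_eq_zero.1 (hχ.eq_zero_of_forall_mul_left fun x => ?_)
    have h1 : a * (y - z) = 0 := by rw [mul_sub, sub_eq_zero]; exact hyz
    have h2 := ha ((y - z) * (x * (u⁻¹ : Rˣ)))
    rw [← mul_assoc a, h1, zero_mul, AddChar.map_zero_eq_one, mul_assoc, mul_assoc,
      Units.inv_mul, mul_one] at h2
    exact h2
  obtain ⟨d, hd⟩ := Finite.injective_iff_surjective.1 hinj 1
  replace hd : a * d = 1 := hd
  have hunit : IsUnit a := by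
    by_contra hna
    obtain ⟨k, hk, hka⟩ := exists_mul_eq_zero_of_not_isUnit hna
    exact hk (by rw [← mul_one k, ← hd, ← mul_assoc, hka, zero_mul])
  exact ⟨hunit.unit, ha⟩

/-- The Nakayama map permutes the units, so the homogeneous weight can be averaged on either side.
-/
theorem sum_unit_mul_comm [Fintype Rˣ] (x : R) :
    ∑ u : Rˣ, χ (u * x) = ∑ u : Rˣ, χ (x * u) := by
  choose v hv using hχ.exists_unit_mul_comm
  have hinj : Function.Injective v := by
    intro a b hab
    refine Units.ext (sub_eq_zero.1 (hχ.eq_zero_of_forall_mul_right fun x => ?_))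
    rw [mul_sub, AddChar.map_sub_eq_div, hv, hv, hab, div_self (χ.val_isUnit _).ne_zero]
  rw [← (Finite.injective_iff_bijective.1 hinj).sum_comp fun u : Rˣ => χ (u * x)]
  exact Finset.sum_congr rfl fun u _ => (hv u x).symm

end IsGeneratingCharacter

/-! ### The homogeneous weight -/

section Weight

variable {R : Type*} [Ring R] [Finite R] (χ : AddChar R ℂ)

theorem homWeight_eq_sum [Fintype Rˣ] (x : R) :
    homWeight χ x = 1 - (∑ u : Rˣ, χ (u * x)) / Fintype.card Rˣ := by
  rw [homWeight, finsum_eq_sum_of_fintype, Nat.card_eq_fintype_card]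

theorem homWeight_unit_mul (u : Rˣ) (x : R) : homWeight χ (u * x) = homWeight χ x := by
  have : Fintype Rˣ := Fintype.ofFinite _
  rw [homWeight_eq_sum, homWeight_eq_sum]
  congr 2
  exact Fintype.sum_equiv (Equiv.mulRight u) _ _ fun v => by simp [mul_assoc]

theorem re_homWeight_nonneg (x : R) : 0 ≤ (homWeight χ x).re := by
  have : Fintype Rˣ := Fintype.ofFinite _
  have hle : ‖(∑ u : Rˣ, χ (u * x)) / (Fintype.card Rˣ : ℂ)‖ ≤ 1 := by
    rw [norm_div, Complex.norm_natCast]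
    refine div_le_one_of_le₀ ((norm_sum_le _ _).trans ?_) (Nat.cast_nonneg _)
    simp
  rw [homWeight_eq_sum, Complex.sub_re, Complex.one_re, sub_nonneg]
  exact (Complex.re_le_norm _).trans hle

variable {n : ℕ}

theorem re_wordWeight_nonneg (c : Fin n → R) : 0 ≤ (wordWeight χ c).re := by
  rw [wordWeight, Complex.re_sum]
  exact Finset.sum_nonneg fun j _ => re_homWeight_nonneg χ _

theorem wordWeight_unit_smul (u : Rˣ) (c : Fin n → R) :
    wordWeight χ ((u : R) • c) = wordWeight χ c :=
  Finset.sum_congr rfl fun _ _ => homWeight_unit_mul χ u _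

theorem wordWeight_neg (c : Fin n → R) : wordWeight χ (-c) = wordWeight χ c := by
  have := wordWeight_unit_smul χ (-1) c
  simpa using this

theorem wordWeight_zero : wordWeight χ (0 : Fin n → R) = 0 := by
  have : Fintype Rˣ := Fintype.ofFinite _
  have h : homWeight χ (0 : R) = 0 := by
    rw [homWeight_eq_sum]
    simp
  simp [wordWeight, h]

/-- If only the zero word has weight zero, then `Γ(C)` is a Cayley graph of `C` itself. -/
theorem exists_equiv_codeGraph_adj (D : AddSubgroup (Fin n → R)) {w : ℝ} (hw : w ≠ 0)
    (hD : ∀ c ∈ D, wordWeight χ c = 0 → c = 0) :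
    ∃ e : (D ⧸ zeroWeightSubgroup χ D) ≃+ D, ∀ v w', (codeGraph χ D w).Adj v w' ↔
      wordWeight χ ((e w' - e v : D) : Fin n → R) = w := by
  have hbot : zeroWeightSubgroup χ D = ⊥ := by
    rw [zeroWeightSubgroup, AddSubgroup.closure_eq_bot_iff]
    intro c hc
    exact Subtype.ext (hD c c.2 hc)
  let e : (D ⧸ zeroWeightSubgroup χ D) ≃+ D :=
    (QuotientAddGroup.quotientAddEquivOfEq hbot).trans QuotientAddGroup.quotientBot
  have he : ∀ c : D, e (QuotientAddGroup.mk c) = c := fun c => rfl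
  refine ⟨e, fun v w' => ?_⟩
  have hmem : ∀ x, x ∈ (fun c : D => (QuotientAddGroup.mk c : D ⧸ zeroWeightSubgroup χ D)) ''
      {c : D | wordWeight χ (c : Fin n → R) = (w : ℂ)} ↔
      wordWeight χ (e x : Fin n → R) = w := by
    intro x
    constructor
    · rintro ⟨c, hc, rfl⟩
      rw [he]; exact hc
    · intro hx
      exact ⟨e x, hx, e.injective (he _)⟩
  rw [codeGraph, SimpleGraph.addCayley_adj, hmem, hmem, map_add, map_add, map_neg, map_neg,
    neg_add_eq_sub, neg_add_eq_sub]
  have hsymm : wordWeight χ ((e v - e w' : D) : Fin n → R) =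
      wordWeight χ ((e w' - e v : D) : Fin n → R) := by
    rw [← wordWeight_neg, ← AddSubgroup.coe_neg, neg_sub]
  rw [hsymm, or_self]
  refine ⟨fun h => h.2, fun h => ⟨?_, h⟩⟩
  rintro rfl
  rw [sub_self, AddSubgroup.coe_zero, wordWeight_zero] at h
  exact hw (by exact_mod_cast h.symm)

end Weight

/-! ### Separating characters and quotients -/

/-- A separating subgroup of the character group is the whole group. -/
theorem eq_top_of_separating {A : Type*} [AddCommGroup A] [Finite A]
    (H : AddSubgroup (AddChar A ℂ)) (hH : ∀ c : A, (∀ ψ ∈ H, ψ c = 1) → c = 0) : H = ⊤ := by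
  classical
  have : Fintype A := Fintype.ofFinite A
  let s : Finset (AddChar A ℂ) := Finset.univ.filter (· ∈ H)
  have hs : ∀ ψ, ψ ∈ H ↔ ψ ∈ s := fun ψ => by simp [s]
  have h1 : ∀ c : A, ∑ ψ ∈ s, ψ c = if c = 0 then (s.card : ℂ) else 0 := by
    intro c
    split_ifs with hc
    · simp [hc]
    · rcases sum_subgroup_apply H s hs (AddChar.doubleDualEmb c) with h | h
      · exact absurd (hH c fun ψ hψ => h.2 ψ ((hs ψ).1 hψ)) hc
      · exact h.1
  -- Double counting: summing over `c` first gives `|A|` from the trivial character alone, so `|H| =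
  -- |A|`.
  have h2 : (∑ c : A, ∑ ψ ∈ s, ψ c) = s.card := by simp [h1]
  rw [Finset.sum_comm] at h2
  simp only [sum_apply_eq_ite_card] at h2
  rw [Finset.sum_ite_eq', if_pos ((hs 0).1 H.zero_mem), ← AddChar.card_eq] at h2
  have h3 : s = Finset.univ := Finset.eq_univ_of_card s (by exact_mod_cast h2.symm)
  rw [eq_top_iff]
  intro ψ _
  rw [hs, h3]
  exact Finset.mem_univ _

/-- Two surjective homomorphisms with the same kernel have isomorphic targets. -/
theorem exists_addEquiv_of_ker_eq {X Y Z : Type*} [AddCommGroup X] [AddCommGroup Y]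
    [AddCommGroup Z] (f : X →+ Y) (g : X →+ Z) (hf : Function.Surjective f)
    (hg : Function.Surjective g) (h : f.ker = g.ker) : ∃ e : Y ≃+ Z, ∀ x, e (f x) = g x := by
  refine ⟨(QuotientAddGroup.quotientKerEquivOfSurjective f hf).symm.trans
    ((QuotientAddGroup.quotientAddEquivOfEq h).trans
      (QuotientAddGroup.quotientKerEquivOfSurjective g hg)), fun x => ?_⟩
  have : (QuotientAddGroup.quotientKerEquivOfSurjective f hf).symm (f x) =
      QuotientAddGroup.mk x := by
    rw [AddEquiv.symm_apply_eq]; rfl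
  rw [AddEquiv.trans_apply, this]
  rfl

/-! ### Characters of a modular code -/

section Code

variable {R : Type*} [Ring R] {n : ℕ}

/-- The character `c ↦ χ (∑ⱼ cⱼ aⱼ)` of a code. -/
noncomputable def codeChar (χ : AddChar R ℂ) (D : AddSubgroup (Fin n → R)) :
    (Fin n → R) →+ AddChar D ℂ where
  toFun a :=
    { toFun := fun c => χ ((c : Fin n → R) ⬝ᵥ a)
      map_zero_eq_one' := by simp
      map_add_eq_mul' := fun c d => by
        rw [AddSubgroup.coe_add, add_dotProduct, AddChar.map_add_eq_mul] }
  map_zero' := by ext c; simp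
  map_add' a b := by ext c; simp [dotProduct_add, AddChar.map_add_eq_mul]

theorem codeChar_apply (χ : AddChar R ℂ) (D : AddSubgroup (Fin n → R)) (a : Fin n → R) (c : D) :
    codeChar χ D a c = χ ((c : Fin n → R) ⬝ᵥ a) := rfl

/-- For fixed `a` the products `c ⬝ᵥ a` form a left ideal, and `χ` is nontrivial on any nonzero one.
-/
theorem codeChar_eq_zero_iff {χ : AddChar R ℂ} (hχ : IsGeneratingCharacter χ)
    (C : Submodule R (Fin n → R)) (a : Fin n → R) :
    codeChar χ C.toAddSubgroup a = 0 ↔ ∀ c ∈ C, c ⬝ᵥ a = 0 := by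
  rw [AddChar.eq_zero_iff]
  constructor
  · intro h c hc
    refine hχ.eq_zero_of_forall_mul_right fun x => ?_
    have := h ⟨x • c, C.smul_mem x hc⟩
    rwa [codeChar_apply, smul_dotProduct, smul_eq_mul] at this
  · intro h c
    rw [codeChar_apply, h c c.2, AddChar.map_zero_eq_one]

/-- The image separates words: vectors `a` supported on one coordinate test `χ (c_j x)` for all `x`.
-/
theorem codeChar_surjective [Finite R] {χ : AddChar R ℂ} (hχ : IsGeneratingCharacter χ)
    (C : Submodule R (Fin n → R)) : Function.Surjective (codeChar χ C.toAddSubgroup) := by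
  rw [← AddMonoidHom.range_eq_top]
  refine eq_top_of_separating _ fun c hc => Subtype.ext (funext fun j => ?_)
  refine hχ.eq_zero_of_forall_mul_left fun x => ?_
  have := hc (codeChar χ C.toAddSubgroup (Pi.single j x)) ⟨_, rfl⟩
  rwa [codeChar_apply, dotProduct_single] at this

/-- The characters `c ↦ χ (cⱼ u)` of a code, for coordinates `j` and units `u`. -/
noncomputable def coordChars [Finite R] (χ : AddChar R ℂ) (D : AddSubgroup (Fin n → R)) :
    Finset (AddChar D ℂ) :=
  letI : Fintype Rˣ := Fintype.ofFinite _
  Finset.univ.image fun p : Fin n × Rˣ => codeChar χ D (Pi.single p.1 (p.2 : R))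

theorem mem_coordChars [Finite R] {χ : AddChar R ℂ} {D : AddSubgroup (Fin n → R)}
    {ψ : AddChar D ℂ} :
    ψ ∈ coordChars χ D ↔ ∃ (j : Fin n) (u : Rˣ), codeChar χ D (Pi.single j (u : R)) = ψ := by
  simp [coordChars]

/-- The number of units that fix `g` times the size of the orbit of `g`. -/
theorem card_fixing_mul_ncard_unitOrbit [Finite R] {k : ℕ} (g : Fin k → R) :
    Nat.card {u : Rˣ // (fun i => g i * (u : R)) = g} * (unitOrbit g).ncard = Nat.card Rˣ := by
  classical
  have : Fintype Rˣ := Fintype.ofFinite _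
  have : Fintype R := Fintype.ofFinite _
  let f : Rˣ → Fin k → R := fun u i => g i * (u : R)
  have h1 : (unitOrbit g).ncard = (Finset.univ.image f).card := by
    rw [← Set.ncard_coe_finset, Finset.coe_image, Finset.coe_univ, Set.image_univ]; rfl
  rw [h1, Nat.card_eq_fintype_card (α := Rˣ), ← Finset.card_univ (α := Rˣ),
    Finset.card_eq_sum_card_image f Finset.univ, mul_comm, ← smul_eq_mul, ← Finset.sum_const]
  refine Finset.sum_congr rfl fun b hb => ?_
  obtain ⟨u₀, -, rfl⟩ := Finset.mem_image.1 hb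
  rw [← Fintype.card_subtype, ← Nat.card_eq_fintype_card]
  refine Nat.card_congr ((Equiv.mulRight u₀).subtypeEquiv fun u => ?_)
  simp only [f, Equiv.coe_mulRight, Units.val_mul, funext_iff, ← mul_assoc]
  exact forall_congr' fun i => (Units.mul_left_inj u₀).symm

theorem exists_unit_of_point_eq [Finite R] {k : ℕ} {g h : Fin k → R} (hgh : point g = point h) :
    ∃ u : Rˣ, (fun i => g i * (u : R)) = h := by
  have : Finite Rᵐᵒᵖ := Finite.of_equiv R MulOpposite.opEquiv
  obtain ⟨u, hu⟩ := exists_unit_smul_eq_of_span_eq hgh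
  refine ⟨(Units.opEquiv u).unop, ?_⟩
  rw [← hu]
  rfl

theorem point_eq_of_unit {k : ℕ} (g : Fin k → R) (u : Rˣ) :
    point (fun i => g i * (u : R)) = point g := by
  apply le_antisymm
  · refine Submodule.span_le.2 (Set.singleton_subset_iff.2 ?_)
    exact Submodule.mem_span_singleton.2 ⟨MulOpposite.op (u : R), rfl⟩
  · refine Submodule.span_le.2 (Set.singleton_subset_iff.2 ?_)
    refine Submodule.mem_span_singleton.2 ⟨MulOpposite.op ((u⁻¹ : Rˣ) : R), ?_⟩
    ext i
    simp [mul_assoc]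

/-- The number of pairs `(j, u)` of a column and a unit with a given product. -/
theorem card_column_unit_eq [Finite R] {k : ℕ} (G : Matrix (Fin k) (Fin n) R) {r : ℚ}
    (g : Fin k → R) (hg : (pointMultiplicity G g : ℚ) = r * ((unitOrbit g).ncard : ℚ)) (u₀ : Rˣ) :
    (Nat.card {p : Fin n × Rˣ // (fun i => G i p.1 * (p.2 : R)) = fun i => g i * (u₀ : R)} : ℚ) =
      r * Nat.card Rˣ := by
  -- If column `j` equals `g v_j`, the pair `(j, u)` corresponds to `j` and the unit `v_j u u₀⁻¹`,
  -- which fixes `g`. The orbit-stabilizer formula then turns the modular multiplicity into `r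
  -- |Rˣ|`.
  have e : {p : Fin n × Rˣ // (fun i => G i p.1 * (p.2 : R)) = fun i => g i * (u₀ : R)} ≃
      {j : Fin n // point (fun i => G i j) = point g} ×
        {u : Rˣ // (fun i => g i * (u : R)) = g} := by
    have hex : ∀ j : {j : Fin n // point (fun i => G i j) = point g},
        ∃ u : Rˣ, (fun i => g i * (u : R)) = fun i => G i j :=
      fun j => exists_unit_of_point_eq j.2.symm
    choose v hv using hex
    have hiff : ∀ (j : {j : Fin n // point (fun i => G i j) = point g}) (u : Rˣ),
        (fun i => g i * ((v j * u * u₀⁻¹ : Rˣ) : R)) = g ↔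
          (fun i => G i j * (u : R)) = fun i => g i * (u₀ : R) := by
      intro j u
      simp only [funext_iff]
      refine forall_congr' fun i => ?_
      rw [← congrFun (hv j) i, Units.val_mul, Units.val_mul, ← mul_assoc, ← mul_assoc,
        Units.mul_inv_eq_iff_eq_mul]
    refine
      { toFun := fun p => ?_
        invFun := fun q => ⟨(q.1, (v q.1)⁻¹ * q.2 * u₀), ?_⟩
        left_inv := ?_
        right_inv := ?_ }
    · have hp : point (fun i => G i p.1.1) = point g := by
        rw [← point_eq_of_unit _ p.1.2, p.2, point_eq_of_unit]
      exact (⟨p.1.1, hp⟩, ⟨v ⟨p.1.1, hp⟩ * p.1.2 * u₀⁻¹, (hiff ⟨p.1.1, hp⟩ p.1.2).2 p.2⟩)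
    · rw [← hiff]
      have : v q.1 * ((v q.1)⁻¹ * q.2 * u₀) * u₀⁻¹ = q.2 := by group
      rw [this]
      exact q.2.2
    · intro p
      apply Subtype.ext
      apply Prod.ext
      · rfl
      · simp only
        group
    · intro q
      apply Prod.ext
      · rfl
      · apply Subtype.ext
        simp only
        group
  rw [Nat.card_congr e, Nat.card_prod, Nat.cast_mul]
  change (pointMultiplicity G g : ℚ) * _ = _
  rw [hg, ← card_fixing_mul_ncard_unitOrbit g]
  push_cast
  ring

theorem codeChar_single_eq_iff {χ : AddChar R ℂ} (hχ : IsGeneratingCharacter χ)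
    (C : Submodule R (Fin n → R)) {k : ℕ} (G : Matrix (Fin k) (Fin n) R)
    (hG : (C : Set (Fin n → R)) = Set.range (fun x : Fin k → R => x ᵥ* G))
    (j j' : Fin n) (x x' : R) :
    codeChar χ C.toAddSubgroup (Pi.single j x) = codeChar χ C.toAddSubgroup (Pi.single j' x') ↔
      (fun i => G i j * x) = fun i => G i j' * x' := by
  rw [← sub_eq_zero, ← map_sub, codeChar_eq_zero_iff hχ]
  have hmem : ∀ c, c ∈ C ↔ ∃ y : Fin k → R, y ᵥ* G = c := fun c => by
    rw [← SetLike.mem_coe, hG]; rfl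
  simp only [hmem, forall_exists_index, forall_apply_eq_imp_iff, dotProduct_sub,
    dotProduct_single, sub_eq_zero]
  constructor
  · intro h
    ext i
    have := h (Pi.single i 1)
    simpa using this
  · intro h y
    simp only [Matrix.vecMul, dotProduct, Finset.sum_mul, mul_assoc]
    exact Finset.sum_congr rfl fun i _ => by rw [congrFun h i]

/-- This is where modularity enters: characters agree iff the scaled columns of `G` do, and the
point of a nonzero column has nonzero multiplicity. -/
theorem card_codeChar_single_eq [Finite R] {χ : AddChar R ℂ} (hχ : IsGeneratingCharacter χ)
    {C : Submodule R (Fin n → R)} {r : ℚ} (hmod : IsModularCode C r) {ψ : AddChar C.toAddSubgroup ℂ}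
    (hψ : ψ ∈ coordChars χ C.toAddSubgroup) :
    (Nat.card {p : Fin n × Rˣ // codeChar χ C.toAddSubgroup (Pi.single p.1 (p.2 : R)) = ψ} : ℚ) =
      r * Nat.card Rˣ := by
  obtain ⟨hnz, k, G, hG, hmult⟩ := hmod
  obtain ⟨j, u, rfl⟩ := mem_coordChars.1 hψ
  simp only [codeChar_single_eq_iff hχ C G hG]
  refine card_column_unit_eq G (fun i => G i j) ?_ u
  refine (hmult _ fun h0 => ?_).resolve_left ?_
  · obtain ⟨c, hc, hcj⟩ := hnz j
    rw [← SetLike.mem_coe, hG] at hc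
    obtain ⟨y, rfl⟩ := hc
    refine hcj ?_
    simp only [Matrix.vecMul]
    rw [h0, dotProduct_zero]
  · have : Nonempty {j' : Fin n // point (fun i => G i j') = point fun i => G i j} := ⟨⟨j, rfl⟩⟩
    exact Nat.card_pos.ne'

/-- The weight averages `χ (c_j u)` over units; grouping the pairs `(j, u)` by character gives each
element of `S` the coefficient `r`. -/
theorem wordWeight_eq_charSum [Finite R] {χ : AddChar R ℂ} (hχ : IsGeneratingCharacter χ)
    {C : Submodule R (Fin n → R)} {r : ℚ} (hmod : IsModularCode C r) (c : C.toAddSubgroup) :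
    wordWeight χ (c : Fin n → R) = n - r * charSum (coordChars χ C.toAddSubgroup) c := by
  classical
  have : Fintype Rˣ := Fintype.ofFinite _
  have hcard : (Fintype.card Rˣ : ℂ) ≠ 0 := by exact_mod_cast Fintype.card_ne_zero
  have h1 : ∑ p : Fin n × Rˣ, codeChar χ C.toAddSubgroup (Pi.single p.1 (p.2 : R)) c =
      r * Fintype.card Rˣ * charSum (coordChars χ C.toAddSubgroup) c := by
    rw [Finset.sum_comp (fun ψ : AddChar C.toAddSubgroup ℂ => ψ c)
      (fun p : Fin n × Rˣ => codeChar χ C.toAddSubgroup (Pi.single p.1 (p.2 : R))), charSum,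
      Finset.mul_sum]
    refine Finset.sum_congr ?_ fun ψ hψ => ?_
    · ext ψ; simp [mem_coordChars]
    · have h2 := card_codeChar_single_eq hχ hmod (ψ := ψ)
        (by simpa [mem_coordChars] using hψ)
      rw [Nat.card_eq_fintype_card, Fintype.card_subtype, Nat.card_eq_fintype_card] at h2
      rw [nsmul_eq_mul]
      congr 1
      exact_mod_cast congrArg (fun q : ℚ => (q : ℂ)) h2
  rw [wordWeight]
  simp only [homWeight_eq_sum, hχ.sum_unit_mul_comm]
  rw [Finset.sum_sub_distrib, ← Finset.sum_div]
  rw [Fintype.sum_prod_type] at h1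
  simp only [codeChar_apply, dotProduct_single] at h1
  rw [h1]
  simp only [Finset.sum_const, Finset.card_univ, Fintype.card_fin, nsmul_eq_mul, mul_one]
  field_simp

theorem isTwoWeightConnectionSet_coordChars [Finite R] {χ : AddChar R ℂ}
    (hχ : IsGeneratingCharacter χ) {C : Submodule R (Fin n → R)} {r : ℚ}
    (hmod : IsModularCode C r) {w₁ w₂ : ℝ} (htw : IsTwoWeightCode χ C.toAddSubgroup w₁ w₂)
    (hC₀ : ∀ c ∈ C, wordWeight χ c = 0 → c = 0) :
    (∀ c : C.toAddSubgroup, wordWeight χ (c : Fin n → R) =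
      ((wordWeight χ (c : Fin n → R)).re : ℝ)) ∧
    IsTwoWeightConnectionSet (coordChars χ C.toAddSubgroup)
      (fun c : C.toAddSubgroup => (wordWeight χ (c : Fin n → R)).re) n r w₁ w₂ := by
  obtain ⟨hlt, hset⟩ := htw
  have hval : ∀ c : C.toAddSubgroup, c ≠ 0 → wordWeight χ (c : Fin n → R) = w₁ ∨
      wordWeight χ (c : Fin n → R) = w₂ := by
    intro c hc
    have : wordWeight χ (c : Fin n → R) ∈ ({(w₁ : ℂ), (w₂ : ℂ)} : Set ℂ) := by
      rw [← hset]
      exact ⟨fun h => hc (Subtype.ext (hC₀ c c.2 h)), c, c.2, rfl⟩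
    simpa using this
  have hreal : ∀ c : C.toAddSubgroup, wordWeight χ (c : Fin n → R) =
      ((wordWeight χ (c : Fin n → R)).re : ℝ) := by
    intro c
    by_cases hc : c = 0
    · subst hc
      rw [AddSubgroup.coe_zero, wordWeight_zero]; simp
    · rcases hval c hc with h | h <;> rw [h] <;> simp
  have h1 : (w₁ : ℂ) ≠ 0 ∧ ∃ c ∈ C.toAddSubgroup, wordWeight χ c = w₁ := by
    have : (w₁ : ℂ) ∈ ({(w₁ : ℂ), (w₂ : ℂ)} : Set ℂ) := by simp
    rw [← hset] at this
    exact this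
  have h2 : (w₂ : ℂ) ≠ 0 ∧ ∃ c ∈ C.toAddSubgroup, wordWeight χ c = w₂ := by
    have : (w₂ : ℂ) ∈ ({(w₁ : ℂ), (w₂ : ℂ)} : Set ℂ) := by simp
    rw [← hset] at this
    exact this
  obtain ⟨hw₁, c₁, hc₁, hc₁w⟩ := h1
  obtain ⟨-, c₂, hc₂, hc₂w⟩ := h2
  refine ⟨hreal, ?_⟩
  refine
    { zero_notMem := fun h0 => ?_
      neg_mem := fun ψ hψ => ?_
      wt_eq := fun c => ?_
      wt_zero := by rw [AddSubgroup.coe_zero, wordWeight_zero, Complex.zero_re]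
      wt_ne_zero := fun c hc => (hval c hc).imp (fun h => by rw [h, Complex.ofReal_re])
        (fun h => by rw [h, Complex.ofReal_re])
      exists_fst := ⟨⟨c₁, hc₁⟩, by rw [hc₁w, Complex.ofReal_re]⟩
      exists_snd := ⟨⟨c₂, hc₂⟩, by rw [hc₂w, Complex.ofReal_re]⟩
      pos := ?_
      lt := hlt
      r_pos := ?_ }
  · obtain ⟨j, u, hju⟩ := mem_coordChars.1 h0
    obtain ⟨c, hc, hcj⟩ := hmod.1 j
    have := (codeChar_eq_zero_iff hχ C _).1 hju c hc
    rw [dotProduct_single] at this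
    exact hcj (by simpa using this)
  · obtain ⟨j, u, rfl⟩ := mem_coordChars.1 hψ
    refine mem_coordChars.2 ⟨j, -u, ?_⟩
    rw [← map_neg, Units.val_neg, Pi.single_neg]
  · rw [← hreal c, wordWeight_eq_charSum hχ hmod]
    simp
  · have h3 := re_wordWeight_nonneg χ c₁
    rw [hc₁w, Complex.ofReal_re] at h3
    exact lt_of_le_of_ne h3 fun h => hw₁ (by rw [← h]; simp)
  · have hn : n ≠ 0 := by
      rintro rfl
      refine hw₁ ?_
      rw [← hc₁w]
      simp [wordWeight]
    have hj : Nonempty (Fin n) := ⟨⟨0, Nat.pos_of_ne_zero hn⟩⟩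
    obtain ⟨j⟩ := hj
    have h3 := card_codeChar_single_eq hχ hmod (mem_coordChars.2 ⟨j, 1, rfl⟩)
    have hne : Nonempty {p : Fin n × Rˣ // codeChar χ C.toAddSubgroup (Pi.single p.1 (p.2 : R)) =
      codeChar χ C.toAddSubgroup (Pi.single j ((1 : Rˣ) : R))} := ⟨⟨(j, 1), rfl⟩⟩
    -- `r |Rˣ|` is the size of a nonempty fibre, hence positive.
    have h4 : (0 : ℚ) < r * Nat.card Rˣ := by
      rw [← h3]
      exact_mod_cast Nat.card_pos
    exact_mod_cast pos_of_mul_pos_left h4 (Nat.cast_nonneg _)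

theorem mem_rightColumnCode {m : ℕ} (M : Matrix (Fin m) (Fin n) R) (f : Fin m → R) :
    f ∈ rightColumnCode M ↔ ∃ a : Fin n → R, M *ᵥ a = f := by
  rw [rightColumnCode, Submodule.mem_span_range_iff_exists_fun]
  constructor
  · rintro ⟨c, rfl⟩
    refine ⟨fun j => (c j).unop, ?_⟩
    ext i
    simp [Matrix.mulVec, dotProduct]
  · rintro ⟨a, rfl⟩
    refine ⟨fun j => MulOpposite.op (a j), ?_⟩
    ext i
    simp [Matrix.mulVec, dotProduct]

end Code

/-! ### Weights in the dual code -/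

section Dual

variable {R : Type*} [Ring R] [Finite R] {n : ℕ} (χ : AddChar R ℂ) (C : Submodule R (Fin n → R))
  {w : ℝ} {b : ℕ} (M : Matrix (Fin b) (Fin n) R)

/-- The weight of a word of the code generated by the columns of `M`, whose rows are the words of
weight `w` in `C`, is a character sum over these words. -/
theorem wordWeight_mulVec [Fintype C.toAddSubgroup] (hinj : Function.Injective fun i => M i)
    (hrows : Set.range (fun i => M i) = {c | c ∈ C ∧ wordWeight χ c = (w : ℂ)})
    (hreal : ∀ c : C.toAddSubgroup, wordWeight χ (c : Fin n → R) =
      ((wordWeight χ (c : Fin n → R)).re : ℝ)) (a : Fin n → R) :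
    wordWeight χ (M *ᵥ a) =
      (IsTwoWeightConnectionSet.fst
        (fun c : C.toAddSubgroup => (wordWeight χ (c : Fin n → R)).re) w).card -
      ∑ c ∈ IsTwoWeightConnectionSet.fst
        (fun c : C.toAddSubgroup => (wordWeight χ (c : Fin n → R)).re) w,
        codeChar χ C.toAddSubgroup a c := by
  have : Fintype Rˣ := Fintype.ofFinite _
  have hcard : (Fintype.card Rˣ : ℂ) ≠ 0 := by exact_mod_cast Fintype.card_ne_zero
  obtain ⟨F, hF⟩ : ∃ F, F = IsTwoWeightConnectionSet.fst
    (fun c : C.toAddSubgroup => (wordWeight χ (c : Fin n → R)).re) w := ⟨_, rfl⟩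
  rw [← hF]
  have hmem : ∀ c : C.toAddSubgroup, c ∈ F ↔ wordWeight χ (c : Fin n → R) = w := by
    intro c
    rw [hF, IsTwoWeightConnectionSet.mem_fst]
    constructor
    · intro h; rw [hreal c, h]
    · intro h; rw [h, Complex.ofReal_re]
  have hrow : ∀ i, M i ∈ C ∧ wordWeight χ (M i) = w := by
    intro i
    have : M i ∈ {c | c ∈ C ∧ wordWeight χ c = (w : ℂ)} := hrows ▸ ⟨i, rfl⟩
    exact this
  have hsum : ∀ φ : (Fin n → R) → ℂ, ∑ i, φ (M i) = ∑ c ∈ F, φ c := by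
    intro φ
    refine Finset.sum_bij (fun i _ => (⟨M i, (hrow i).1⟩ : C.toAddSubgroup)) ?_ ?_ ?_ ?_
    · intro i _
      exact (hmem _).2 (hrow i).2
    · intro i _ j _ hij
      exact hinj (congrArg Subtype.val hij)
    · intro c hc
      have : (c : Fin n → R) ∈ Set.range (fun i => M i) := by
        rw [hrows]; exact ⟨c.2, (hmem c).1 hc⟩
      obtain ⟨i, hi⟩ := this
      exact ⟨i, Finset.mem_univ _, Subtype.ext hi⟩
    · intro i _; rfl
  -- Left multiplication by a unit permutes `C₁`, so averaging over units leaves the sum unchanged.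
  have hunit : ∀ u : Rˣ, ∑ c ∈ F, χ ((u : R) * ((c : Fin n → R) ⬝ᵥ a)) =
      ∑ c ∈ F, codeChar χ C.toAddSubgroup a c := by
    intro u
    refine Finset.sum_bij (fun c _ => (⟨(u : R) • (c : Fin n → R), C.smul_mem _ c.2⟩ :
      C.toAddSubgroup)) ?_ ?_ ?_ ?_
    · intro c hc
      rw [hmem] at hc ⊢
      rw [wordWeight_unit_smul, hc]
    · intro c _ d _ hcd
      have h1 : u • (c : Fin n → R) = u • (d : Fin n → R) := congrArg Subtype.val hcd
      exact Subtype.ext (smul_left_cancel u h1)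
    · intro c hc
      refine ⟨⟨((u⁻¹ : Rˣ) : R) • (c : Fin n → R), C.smul_mem _ c.2⟩, ?_, ?_⟩
      · rw [hmem] at hc ⊢
        rw [wordWeight_unit_smul, hc]
      · apply Subtype.ext
        exact smul_inv_smul u (c : Fin n → R)
    · intro c _
      rw [codeChar_apply, smul_dotProduct, smul_eq_mul]
  have h1 : wordWeight χ (M *ᵥ a) = ∑ i, homWeight χ (M i ⬝ᵥ a) := rfl
  rw [h1, hsum (fun c => homWeight χ (c ⬝ᵥ a))]
  simp only [homWeight_eq_sum]
  rw [Finset.sum_sub_distrib, ← Finset.sum_div, Finset.sum_comm]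
  simp only [hunit]
  simp only [Finset.sum_const, Finset.card_univ, nsmul_eq_mul, mul_one]
  rw [mul_div_cancel_left₀ _ hcard]

end Dual

end TwoWeight

/-! ### The main theorem -/

open TwoWeight TwoWeight.IsTwoWeightConnectionSet

theorem mainTheorem3 {R : Type*} [Ring R] [Finite R]
    (χ : AddChar R ℂ) (hχ : TwoWeight.IsGeneratingCharacter χ)
    {n : ℕ} (C : Submodule R (Fin n → R)) (r : ℚ) (hmod : TwoWeight.IsModularCode C r)
    (w₁ w₂ : ℝ) (htw : TwoWeight.IsTwoWeightCode χ C.toAddSubgroup w₁ w₂)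
    (hC₀ : ∀ c ∈ C, TwoWeight.wordWeight χ c = 0 → c = 0)
    -- the rows of the matrix `M₁` are the words of weight `w₁`, in some order
    {b₁ : ℕ} (M₁ : Matrix (Fin b₁) (Fin n) R) (hinj : Function.Injective fun i => M₁ i)
    (hrows : Set.range (fun i => M₁ i) = {c | c ∈ C ∧ TwoWeight.wordWeight χ c = (w₁ : ℂ)}) :
    ∃ w₁' w₂' : ℝ,
      TwoWeight.IsTwoWeightCode χ (TwoWeight.rightColumnCode M₁).toAddSubgroup w₁' w₂' ∧
      (∃ K' ℓ' μ' : ℕ,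
        TwoWeight.IsStronglyRegular
          (TwoWeight.codeGraph χ (TwoWeight.rightColumnCode M₁).toAddSubgroup w₁')
          (Nat.card C) K' ℓ' μ' ∧
        (K' : ℝ) = (n : ℝ) / (r : ℝ) ∧
        (ℓ' : ℝ) = (2 * (n : ℝ) - w₁ - w₂) / (r : ℝ) +
          w₁ * w₂ / ((r : ℝ) ^ 2 * (Nat.card C : ℝ)) ∧
        (μ' : ℝ) = w₁ * w₂ / ((r : ℝ) ^ 2 * (Nat.card C : ℝ))) ∧
      (TwoWeight.IsTrivialGraph
          (TwoWeight.codeGraph χ (TwoWeight.rightColumnCode M₁).toAddSubgroup w₁') ↔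
        w₁ = (n : ℝ)) ∧
      (TwoWeight.IsTrivialGraph
          (TwoWeight.codeGraph χ (TwoWeight.rightColumnCode M₁).toAddSubgroup w₁') ↔
        TwoWeight.IsTrivialGraph (TwoWeight.codeGraph χ C.toAddSubgroup w₁)) := by

  classical
  have : Fintype C.toAddSubgroup := Fintype.ofFinite _
  obtain ⟨hreal, h⟩ := isTwoWeightConnectionSet_coordChars hχ hmod htw hC₀
  obtain ⟨S, hS⟩ : ∃ S, S = coordChars χ C.toAddSubgroup := ⟨_, rfl⟩
  obtain ⟨wt, hwt⟩ : ∃ wt : C.toAddSubgroup → ℝ,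
    wt = fun c : C.toAddSubgroup => (wordWeight χ (c : Fin n → R)).re := ⟨_, rfl⟩
  have hweight := wordWeight_mulVec χ C M₁ hinj hrows hreal
  rw [← hS, ← hwt] at h
  rw [← hwt] at hweight
  let Φ := codeChar χ C.toAddSubgroup
  have hΦ : Function.Surjective Φ := codeChar_surjective hχ C
  replace hweight : ∀ a, wordWeight χ (M₁ *ᵥ a) =
    (fst wt w₁).card - ∑ c ∈ fst wt w₁, Φ a c := hweight
  -- The dual weights are `|C₁|` minus the two possible sums of a nontrivial character over `C₁`.
  obtain ⟨w₁', hw₁'⟩ : ∃ x : ℝ, x = (fst wt w₁).card -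
    (r * Fintype.card C.toAddSubgroup - w₂) / (w₂ - w₁) := ⟨_, rfl⟩
  obtain ⟨w₂', hw₂'⟩ : ∃ x : ℝ, x = (fst wt w₁).card - (- w₂ / (w₂ - w₁)) := ⟨_, rfl⟩
  have hlt' : w₁' < w₂' := by
    have := h.sum_fst_lt
    rw [hw₁', hw₂']; linarith
  have hzero : ∀ a, Φ a = 0 → wordWeight χ (M₁ *ᵥ a) = 0 := by
    intro a ha
    rw [hweight, ha]; simp
  have hnonzero : ∀ a, Φ a ≠ 0 → wordWeight χ (M₁ *ᵥ a) ≠ 0 := by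
    intro a ha h0
    rw [hweight, sub_eq_zero] at h0
    exact h.sum_fst_ne_card ha h0.symm
  have hin : ∀ a, Φ a ∈ S → wordWeight χ (M₁ *ᵥ a) = w₁' := by
    intro a ha
    rw [hweight, h.sum_fst_of_mem ha, hw₁']; push_cast; rfl
  have hout : ∀ a, Φ a ≠ 0 → Φ a ∉ S → wordWeight χ (M₁ *ᵥ a) = w₂' := by
    intro a h0 ha
    rw [hweight, h.sum_fst_of_notMem h0 ha, hw₂']; push_cast; rfl
  have hS0 : ∀ a, Φ a ∈ S → Φ a ≠ 0 := fun a ha h0 => h.zero_notMem (h0 ▸ ha)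
  have hw₁'0 : w₁' ≠ 0 := by
    intro h0
    obtain ⟨ψ, hψ⟩ := h.exists_mem
    obtain ⟨a, rfl⟩ := hΦ ψ
    refine hnonzero a (hS0 a hψ) ?_
    rw [hin a hψ, h0]; simp
  have hiff : ∀ a, wordWeight χ (M₁ *ᵥ a) = w₁' ↔ Φ a ∈ S := by
    intro a
    refine ⟨fun ha => ?_, hin a⟩
    by_contra hnot
    by_cases h0 : Φ a = 0
    · rw [hzero a h0] at ha
      exact hw₁'0 (by exact_mod_cast ha.symm)
    · rw [hout a h0 hnot] at ha
      exact hlt'.ne' (by exact_mod_cast ha)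
  -- The maps `a ↦ M₁ *ᵥ a` and `Φ` have the same kernel, which identifies `C'` with the character
  -- group of `C`.
  have hker : ∀ a, Φ a = 0 ↔ M₁ *ᵥ a = 0 := by
    intro a
    constructor
    · intro ha
      ext i
      refine (codeChar_eq_zero_iff hχ C a).1 ha (M₁ i) ?_
      have : M₁ i ∈ {c | c ∈ C ∧ wordWeight χ c = (w₁ : ℂ)} := hrows ▸ ⟨i, rfl⟩
      exact this.1
    · intro ha
      by_contra h0
      refine hnonzero a h0 ?_
      rw [ha, wordWeight_zero]
  have htw' : IsTwoWeightCode χ (rightColumnCode M₁).toAddSubgroup w₁' w₂' := by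
    refine ⟨hlt', Set.ext fun t => ⟨?_, ?_⟩⟩
    · rintro ⟨ht, f, hf, rfl⟩
      obtain ⟨a, rfl⟩ := (mem_rightColumnCode M₁ f).1 hf
      have h0 : Φ a ≠ 0 := fun h0 => ht (hzero a h0)
      by_cases ha : Φ a ∈ S
      · exact Or.inl (hin a ha)
      · exact Or.inr (hout a h0 ha)
    · rintro (rfl | rfl)
      · obtain ⟨ψ, hψ⟩ := h.exists_mem
        obtain ⟨a, rfl⟩ := hΦ ψ
        exact ⟨by exact_mod_cast hw₁'0, _, (mem_rightColumnCode M₁ _).2 ⟨a, rfl⟩, hin a hψ⟩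
      · obtain ⟨ψ, h0, hψ⟩ := h.exists_notMem
        obtain ⟨a, rfl⟩ := hΦ ψ
        exact ⟨hout a h0 hψ ▸ hnonzero a h0, _, (mem_rightColumnCode M₁ _).2 ⟨a, rfl⟩,
          hout a h0 hψ⟩
  obtain ⟨e₀, he₀⟩ := exists_equiv_codeGraph_adj χ (rightColumnCode M₁).toAddSubgroup hw₁'0
    (fun f hf hf0 => by
      obtain ⟨a, rfl⟩ := (mem_rightColumnCode M₁ f).1 hf
      rw [← hker]
      by_contra h0
      exact hnonzero a h0 hf0)
  let ρ : (Fin n → R) →+ (rightColumnCode M₁).toAddSubgroup :=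
    { toFun := fun a => ⟨M₁ *ᵥ a, (mem_rightColumnCode M₁ _).2 ⟨a, rfl⟩⟩
      map_zero' := Subtype.ext (Matrix.mulVec_zero M₁)
      map_add' := fun a b => Subtype.ext (Matrix.mulVec_add M₁ a b) }
  have hρ : Function.Surjective ρ := by
    rintro ⟨f, hf⟩
    obtain ⟨a, rfl⟩ := (mem_rightColumnCode M₁ f).1 hf
    exact ⟨a, rfl⟩
  obtain ⟨e₁, he₁⟩ := exists_addEquiv_of_ker_eq ρ Φ hρ hΦ (by
    ext a
    rw [AddMonoidHom.mem_ker, AddMonoidHom.mem_ker, hker]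
    exact Subtype.ext_iff)
  let e := e₀.trans e₁
  have hadj : ∀ v w, (codeGraph χ (rightColumnCode M₁).toAddSubgroup w₁').Adj v w ↔
      e w - e v ∈ (S : Set (AddChar C.toAddSubgroup ℂ)) := by
    intro v w
    obtain ⟨a, ha⟩ := hρ (e₀ w - e₀ v)
    have hd : e w - e v = Φ a := by
      change e₁ (e₀ w) - e₁ (e₀ v) = _
      rw [← map_sub, ← ha, he₁]
    rw [he₀, hd, ← ha]
    exact hiff a
  obtain ⟨e', he'⟩ := exists_equiv_codeGraph_adj χ C.toAddSubgroup h.pos.ne' hC₀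
  have hadj' : ∀ v w, (codeGraph χ C.toAddSubgroup w₁).Adj v w ↔
      e' w - e' v ∈ {c : C.toAddSubgroup | wt c = w₁} := by
    intro v w
    rw [he', hreal]
    simp [hwt]
  have htriv' : IsTrivialGraph (codeGraph χ (rightColumnCode M₁).toAddSubgroup w₁') ↔
      w₁ = (n : ℝ) := by
    rw [isTrivialGraph_iff e.toEquiv hadj, ← h.compl_subgroup_iff]
    exact or_iff_right fun ⟨H, hH⟩ => h.not_subgroup H hH
  have htriv : IsTrivialGraph (codeGraph χ C.toAddSubgroup w₁) ↔ w₁ = (n : ℝ) := by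
    rw [isTrivialGraph_iff e'.toEquiv hadj', ← h.compl_subgroup_fst_iff]
    exact or_iff_right fun ⟨H, hH⟩ => h.not_subgroup_fst H hH
  have hr := h.r_pos
  refine ⟨w₁', w₂', htw', ?_, htriv', htriv'.trans htriv.symm⟩
  have hN : (Nat.card C : ℝ) = Fintype.card C.toAddSubgroup := by
    rw [← Nat.card_eq_fintype_card]; rfl
  have hN' : Nat.card (AddChar C.toAddSubgroup ℂ) = Nat.card C := by
    rw [Nat.card_eq_fintype_card, AddChar.card_eq, ← Nat.card_eq_fintype_card]; rfl
  have hset : ∀ ψ : AddChar C.toAddSubgroup ℂ,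
      {φ | φ ∈ (S : Set (AddChar C.toAddSubgroup ℂ)) ∧ ψ - φ ∈ (S : Set _)}.ncard =
      (S.filter fun φ => ψ - φ ∈ S).card := by
    intro ψ
    rw [← Set.ncard_coe_finset]
    congr 1
    ext φ
    simp
  obtain ⟨ψ₁, hψ₁⟩ := h.exists_mem
  obtain ⟨ψ₂, h0₂, hψ₂⟩ := h.exists_notMem
  have hℓ : ∀ ψ ∈ S, ((S.filter fun φ => ψ - φ ∈ S).card : ℝ) = (2 * n - w₁ - w₂) / r +
      w₁ * w₂ / (r ^ 2 * Fintype.card C.toAddSubgroup) := by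
    intro ψ hψ
    rw [h.card_filter_sub_mem (fun h0 => h.zero_notMem (h0 ▸ hψ)), if_pos hψ]
  have hμ : ∀ ψ, ψ ≠ 0 → ψ ∉ S → ((S.filter fun φ => ψ - φ ∈ S).card : ℝ) =
      w₁ * w₂ / (r ^ 2 * Fintype.card C.toAddSubgroup) := by
    intro ψ h0 hψ
    rw [h.card_filter_sub_mem h0, if_neg hψ, zero_add]
  -- The counts at `ψ₁ ∈ S` and at the nonzero `ψ₂ ∉ S` serve as `λ'` and `μ'`; the closed formulas
  -- show that they do not depend on these choices.
  refine ⟨S.card, (S.filter fun φ => ψ₁ - φ ∈ S).card, (S.filter fun φ => ψ₂ - φ ∈ S).card,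
    ?_, ?_, ?_, ?_⟩
  · rw [← hN', ← Set.ncard_coe_finset S]
    refine isStronglyRegular_of_forall e.toEquiv hadj (fun ψ hψ => ?_) fun ψ h0 hψ => ?_
    · rw [hset]
      exact_mod_cast (hℓ ψ hψ).trans (hℓ ψ₁ hψ₁).symm
    · rw [hset]
      exact_mod_cast (hμ ψ h0 hψ).trans (hμ ψ₂ h0₂ hψ₂).symm
  · rw [h.length_eq, mul_div_cancel_left₀ _ hr.ne']
  · rw [hN, hℓ ψ₁ hψ₁]
  · rw [hN, hμ ψ₂ h0₂ hψ₂]
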